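/- **Setting.** Let $A\ge k\ge 1$ and $T\ge 2$ be integers, $c\in(0,1]$, $\delta\in(0,1)$, and let $\mathcal F$ be a finite class of (measurable) functions $\mathcal X\times[A]\to[0,1]$. In each round $t=1,\dots,T$ a pair $(x_t,(r_t(a))_{a\in[A]})$ of a context $x_t\in\mathcal X$ and rewards $r_t(a)\in[0,1]$ is drawn from a fixed unknown distribution $\mathcal D$, independently of the history $\mathcal H_{t-1}$ of the earlier rounds. The learner observes $x_t$ and chooses a set $\mathcal A_t\subseteq[A]$ of $k$ distinct arms; then the rewards of the arms of a random subset $\Phi_t\subseteq\mathcal A_t$ are revealed. Given $x_t$ and $\mathcal H_{t-1}$, the pair $(\mathcal A_t,\Phi_t)$ is independent of $(r_t(a))_a$. Assume * (realizability) there is $f^*\in\mathcal F$ with $\mathbb E[r_t(a)\mid x_t=x]=f^*(x,a)$ for all $a\in[A]$ and ($\mathcal D$-almost) all $x$; * (feedback) $\mathbb P(a\in\Phi_t\mid x_t,\mathcal A_t,\mathcal H_{t-1})\ge c$ for every $a\in\mathcal A_t$. **Algorithm.** Put $N_0=0$ and $N_l=2^l$ for $l\ge1$; epoch $l\ge 1$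 consists of the rounds $t\le T$ with $N_{l-1}<t\le N_l$. Let $$\gamma_l=\frac1{32}\sqrt{\frac{c\,(A-k+1)\,N_{l-1}}{162\,\log(|\mathcal F|T^3/\delta)}}.$$ At the beginning of epoch $l$ the learner computes a least squares fit $\widehat y_l\in\operatorname{argmin}_{f\in\mathcal F}\sum_{t=1}^{N_{l-1}}\sum_{a\in\Phi_t}(f(x_t,a)-r_t(a))^2$. In each round $t$ of epoch $l$ it orders the arms as $\widehat a^1,\dots,\widehat a^A$ by decreasing values of $\widehat y_l(x_t,\cdot)$ (ties are broken by any fixed measurable rule) and chooses $\mathcal A_t=\{\widehat a^1,\dots,\widehat a^{k-1},a\}$, where $a$ is drawn at random from the remaining arms $\{\widehat a^k,\dots,\widehat a^A\}$ with probabilities $$p(a)=\frac1{(A-k+1)+\gamma_l\,(\widehat y_l(x_t,\widehat a^k)-\widehat y_l(x_t,a))}\quad(a\ne\widehat a^k),\qquad p(\widehat a^k)=1-\sum_{a\ne\widehat a^k}p(a).$$ **Theorem.** There is a universal constant $C$ such that, with $$B:=C\,k\sqrt{c^{-1}(A-k+1)\,T\,\log\!\left(\frac{|\mathcal F|\,T}{\delta}\right)},\qquad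 \Delta_t:=\max_{S\subseteq[A],\,|S|=k}\ \sum_{a\in S}f^*(x_t,a)-\sum_{a\in\mathcal A_t}f^*(x_t,a),$$ the regret satisfies $$\sum_{t=1}^T\mathbb E[\Delta_t\mid\mathcal H_{t-1}]\le B\quad\text{with probability at least }1-\delta,$$ and also the expected regret satisfies $R(T)=\sum_{t=1}^T\mathbb E[\Delta_t]\le B$. -/

import Mathlib

open MeasureTheory ProbabilityTheory

noncomputable section

namespace TopKBandit

variable {X Ω : Type*} {A : ℕ}

/-- The largest value of `∑ a ∈ S, g a` over all sets `S` of exactly `k` distinct arms. -/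
def topValue (k : ℕ) (g : Fin A → ℝ) : ℝ :=
  ⨆ S : {S : Finset (Fin A) // S.card = k}, ∑ a ∈ S.1, g a

/-- The regret of choosing the set of arms `S` when the mean rewards of the arms are `g`. -/
def gap (k : ℕ) (g : Fin A → ℝ) (S : Finset (Fin A)) : ℝ :=
  topValue k g - ∑ a ∈ S, g a

/-- Inverse gap weighting with scaling factor `γ` over the set of arms `s`, for the scores `y`,
where `b` is a maximizer of `y` over `s`: the probability of drawing the arm `a`. -/
def igw (γ : ℝ) (s : Finset (Fin A)) (y : Fin A → ℝ) (b a : Fin A) : ℝ :=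
  if a ∉ s then 0
  else if a = b then 1 - ∑ a' ∈ s.erase b, 1 / ((s.card : ℝ) + γ * (y b - y a'))
  else 1 / ((s.card : ℝ) + γ * (y b - y a))

/-- `π` lists the arms in decreasing order of their scores `y` (ties are in any order). -/
def IsRanking (y : Fin A → ℝ) (π : Equiv.Perm (Fin A)) : Prop :=
  Antitone fun i => y (π i)

/-- The first `k - 1` arms of the list `π`. -/
def greedyArms (k : ℕ) (π : Equiv.Perm (Fin A)) : Finset (Fin A) :=
  Finset.univ.filter fun a => (π.symm a : ℕ) < k - 1

/-- The probability that the algorithm chooses the set of arms `S`, when the scores of the arms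
are `y` and `π` is the list of the arms in decreasing order of the scores: the first `k - 1` arms
of the list are taken, and one further arm is drawn by inverse gap weighting over the other arms.
The best of these other arms is the `k`-th arm of the list. -/
def selectionProb (k : ℕ) (hk : 1 ≤ k) (hkA : k ≤ A) (γ : ℝ) (y : Fin A → ℝ)
    (π : Equiv.Perm (Fin A)) (S : Finset (Fin A)) : ℝ :=
  ∑ a ∈ (greedyArms k π)ᶜ,
    if S = insert a (greedyArms k π) then
      igw γ (greedyArms k π)ᶜ y (π ⟨k - 1, by omega⟩) a
    else 0

/-- The last round of epoch `l`: `N_0 = 0` and `N_l = 2 ^ l` for `l ≥ 1`. Epoch `l ≥ 1` consists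
of the rounds `t` with `N_{l-1} < t ≤ N_l`. -/
def epochEnd (l : ℕ) : ℕ := if l = 0 then 0 else 2 ^ l

/-- The scaling factor of epoch `l`, where `n` is the size of the function class. -/
def scaling (c : ℝ) (A k n T : ℕ) (δ : ℝ) (l : ℕ) : ℝ :=
  1 / 32 * √(c * ((A : ℝ) - k + 1) * (epochEnd (l - 1) : ℝ) /
    (162 * Real.log ((n : ℝ) * (T : ℝ) ^ 3 / δ)))

/-- The random variables of the interaction, indexed by the rounds `t = 1, 2, …`
(by the epochs `l = 1, 2, …` in the case of `estimate`). -/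
structure Interaction (X Ω : Type*) (A : ℕ) where
  /-- the context `x_t` -/
  context : ℕ → Ω → X
  /-- the rewards `r_t(a)` of all arms -/
  reward : ℕ → Ω → Fin A → ℝ
  /-- the set of chosen arms -/
  chosen : ℕ → Ω → Finset (Fin A)
  /-- the set of chosen arms whose rewards are revealed -/
  revealed : ℕ → Ω → Finset (Fin A)
  /-- the regression function fitted at the beginning of epoch `l` -/
  estimate : ℕ → Ω → X → Fin A → ℝ

namespace Interaction

/-- The sum of squared errors of `f` on the feedback of the rounds `1, …, n`. -/
def squaredLoss (I : Interaction X Ω A) (n : ℕ) (f : X → Fin A → ℝ) (ω : Ω) : ℝ :=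
  ∑ t ∈ Finset.Icc 1 n, ∑ a ∈ I.revealed t ω, (f (I.context t ω) a - I.reward t ω a) ^ 2

end Interaction

variable [MeasurableSpace X] [mΩ : MeasurableSpace Ω]

/-- The information consisting of the past `𝓗 (t - 1)` and of the context of round `t`. -/
abbrev infoContext (I : Interaction X Ω A) (𝓗 : Filtration ℕ mΩ) (t : ℕ) : MeasurableSpace Ω :=
  𝓗 (t - 1) ⊔ MeasurableSpace.comap (I.context t) inferInstance

/-- The information consisting of the past, the context and the chosen arms of round `t`. -/
abbrev infoChosen (I : Interaction X Ω A) (𝓗 : Filtration ℕ mΩ) (t : ℕ) : MeasurableSpace Ω :=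
  infoContext I 𝓗 t ⊔ MeasurableSpace.comap (I.chosen t) ⊤

/-- The information consisting of the past, the context, the chosen arms and the set of the
revealed arms of round `t`. -/
abbrev infoRevealed (I : Interaction X Ω A) (𝓗 : Filtration ℕ mΩ) (t : ℕ) : MeasurableSpace Ω :=
  infoChosen I 𝓗 t ⊔ MeasurableSpace.comap (I.revealed t) ⊤

/-- `𝓕` is a class of measurable functions with values in `[0, 1]`. -/
def IsRegressionClass (𝓕 : Finset (X → Fin A → ℝ)) : Prop :=
  ∀ f ∈ 𝓕, ∀ a, Measurable (fun x => f x a) ∧ ∀ x, f x a ∈ Set.Icc (0 : ℝ) 1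

/-- `f` is the regression function of the distribution `D` of (context, rewards of all arms):
the conditional expectation of the reward of the arm `a` given the context `x` is `f x a`. -/
def IsRegressionFunction (D : Measure (X × (Fin A → ℝ))) (f : X → Fin A → ℝ) : Prop :=
  ∀ a, D[fun z => z.2 a | MeasurableSpace.comap Prod.fst inferInstance]
    =ᵐ[D] fun z => f z.1 a

/-- The stochastic environment during the rounds `1, …, T`. The filtration `𝓗` is the history:
`𝓗 t` contains at least what is observed up to round `t`. -/
structure IsEnvironment (P : Measure Ω) (𝓗 : Filtration ℕ mΩ) (I : Interaction X Ω A)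
    (D : Measure (X × (Fin A → ℝ))) (c : ℝ) (T : ℕ) : Prop where
  /-- rewards lie in `[0, 1]` -/
  reward_mem : ∀ᵐ z ∂D, ∀ a, z.2 a ∈ Set.Icc (0 : ℝ) 1
  measurable_reward : ∀ t ∈ Finset.Icc 1 T, Measurable (I.reward t)
  /-- what is observed in round `t` belongs to the history up to round `t` -/
  measurable_context : ∀ t ∈ Finset.Icc 1 T, Measurable[𝓗 t] (I.context t)
  measurable_chosen : ∀ t ∈ Finset.Icc 1 T, ∀ S, MeasurableSet[𝓗 t] {ω | I.chosen t ω = S}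
  measurable_revealed : ∀ t ∈ Finset.Icc 1 T, ∀ S, MeasurableSet[𝓗 t] {ω | I.revealed t ω = S}
  measurable_feedback : ∀ t ∈ Finset.Icc 1 T, ∀ a,
    Measurable[𝓗 t] fun ω => if a ∈ I.revealed t ω then I.reward t ω a else 0
  /-- in every round, context and rewards are drawn from `D`, independently of the past -/
  law : ∀ t ∈ Finset.Icc 1 T, P.map (fun ω => (I.context t ω, I.reward t ω)) = D
  indep : ∀ t ∈ Finset.Icc 1 T,
    Indep (MeasurableSpace.comap (fun ω => (I.context t ω, I.reward t ω)) inferInstance)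
      (𝓗 (t - 1)) P
  /-- given the past and the context, the rewards are independent of the chosen and of the
  revealed arms -/
  condIndep : ∀ t ∈ Finset.Icc 1 T, ∀ B : Set (Fin A → ℝ), MeasurableSet B →
    P⟦I.reward t ⁻¹' B | infoRevealed I 𝓗 t⟧ =ᵐ[P] P⟦I.reward t ⁻¹' B | infoContext I 𝓗 t⟧
  /-- only rewards of chosen arms are revealed -/
  revealed_subset : ∀ t ∈ Finset.Icc 1 T, ∀ ω, I.revealed t ω ⊆ I.chosen t ω
  /-- each chosen arm is revealed with conditional probability at least `c` -/
  feedback : ∀ t ∈ Finset.Icc 1 T, ∀ a, ∀ᵐ ω ∂P, a ∈ I.chosen t ω →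
    c ≤ (P⟦{ω' | a ∈ I.revealed t ω'} | infoChosen I 𝓗 t⟧) ω

/-- The algorithm with one explore slot during the rounds `1, …, T`, with the scaling factors `γ`.
The estimate of epoch `l` is any least squares fit in `𝓕` to the feedback of the rounds up to
`N_{l-1}`, and `rank f x` is the list of the arms in decreasing order of `f x ·`, for an arbitrary
measurable rule of breaking ties. -/
structure IsAlgorithmRun (P : Measure Ω) (𝓗 : Filtration ℕ mΩ) (I : Interaction X Ω A)
    (𝓕 : Finset (X → Fin A → ℝ)) (rank : (X → Fin A → ℝ) → X → Equiv.Perm (Fin A))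
    (k : ℕ) (hk : 1 ≤ k) (hkA : k ≤ A) (γ : ℕ → ℝ) (T : ℕ) : Prop where
  isRanking : ∀ f ∈ 𝓕, ∀ x, IsRanking (f x) (rank f x)
  measurable_rank : ∀ f ∈ 𝓕, ∀ π, MeasurableSet {x | rank f x = π}
  estimate_mem : ∀ l, 1 ≤ l → epochEnd (l - 1) < T → ∀ ω, I.estimate l ω ∈ 𝓕
  estimate_le : ∀ l, 1 ≤ l → epochEnd (l - 1) < T → ∀ ω, ∀ f ∈ 𝓕,
    I.squaredLoss (epochEnd (l - 1)) (I.estimate l ω) ω ≤ I.squaredLoss (epochEnd (l - 1)) f ω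
  measurable_estimate : ∀ l, 1 ≤ l → epochEnd (l - 1) < T → ∀ f ∈ 𝓕,
    MeasurableSet[𝓗 (epochEnd (l - 1))] {ω | I.estimate l ω = f}
  /-- the conditional law, given the past and the context, of the set of chosen arms -/
  selection : ∀ l, 1 ≤ l → ∀ t, epochEnd (l - 1) < t → t ≤ epochEnd l → t ≤ T →
    ∀ S : Finset (Fin A),
      P⟦{ω | I.chosen t ω = S} | infoContext I 𝓗 t⟧ =ᵐ[P] fun ω =>
        selectionProb k hk hkA (γ l) (I.estimate l ω (I.context t ω))
          (rank (I.estimate l ω) (I.context t ω)) S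

/-- The regret `∑_t E[gap_t]` of the rounds `1, …, T`. -/
def regret (P : Measure Ω) (I : Interaction X Ω A) (k : ℕ) (f : X → Fin A → ℝ) (T : ℕ) : ℝ :=
  ∑ t ∈ Finset.Icc 1 T, ∫ ω, gap k (f (I.context t ω)) (I.chosen t ω) ∂P

/-- The regret `∑_t E[gap_t | 𝓗_{t-1}]` of the rounds `1, …, T`, where the expectation in round
`t` is over the context and the choice of the arms in this round, given the past. -/
def condRegret (P : Measure Ω) (𝓗 : Filtration ℕ mΩ) (I : Interaction X Ω A) (k : ℕ)
    (f : X → Fin A → ℝ) (T : ℕ) (ω : Ω) : ℝ :=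
  ∑ t ∈ Finset.Icc 1 T,
    (P[fun ω' => gap k (f (I.context t ω')) (I.chosen t ω') | 𝓗 (t - 1)]) ω

end TopKBandit

end

namespace TopKBandit

/-! ### Ranked arms and fractional choices of `k` arms -/

variable {A : ℕ}

/-! Write `m = A - k + 1`, `K = k * m` and `L = log (|𝓕| T ^ 3 / δ)`. Rewards add up over the chosen
arms, so a random choice of `k` arms matters only through its inclusion probabilities: weights in
`[0, 1]` of total mass `k`. Regret is linear in these weights, and passing to them does not raise
the optimum.

Inverse gap weighting does two things. Measured by its own scores, its loss is at most `m / γ`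
(`mul_topValue_sub_le`). Its inverse inclusion probabilities grow only linearly in the score gaps,
so for any policy `q` the mean deviation of two functions under `q` is bounded by `K`, the estimated
regret of `q` and the mean squared deviation under the algorithm's policy
(`IsFractional.sum_mul_abs_le`).

The squared deviations are controlled by an exponential supermartingale. Given the past, the excess
squared loss of `f` over `fstar` has mean at least `c` times the error of `f` under the current
policy, and its second moment is of the order of `k` times its mean. Hence the process `errorExp`
has expectation at most one (`integral_errorExp_le`). Markov's inequality and a union bound over `f`
and the rounds leave an exceptional event of probability at most `δ / T ^ 2`. Outside it, a least
squares fit has nonpositive excess loss, so its errors under the policies of the `N` rounds it was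
fitted to sum to at most `16 k L / c`. By pigeonhole the policy of some earlier epoch sees an error
of at most `16 k L / (c N)`, which is below `K / γ ^ 2`.

These facts feed an induction over epochs (`policyRegret_comparison`,
`mul_policyRegret_le_of_policyError_le`): true and estimated regret of every policy agree up to a
factor 2 and an additive `9 K / γ`. Applied to the algorithm's own policy, whose estimated regret is
at most `m / γ`, this gives true regret at most `11 K / γ`, of order `k √(m L / (c t))` in round
`t`. Summing over `t` gives the bound; in expectation the exceptional event adds at most `k`. -/

lemma mem_greedyArms {k : ℕ} {π : Equiv.Perm (Fin A)} {a : Fin A} :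
    a ∈ greedyArms k π ↔ (π.symm a : ℕ) < k - 1 := by
  simp [greedyArms]

lemma card_greedyArms {k : ℕ} (hkA : k ≤ A) (π : Equiv.Perm (Fin A)) :
    (greedyArms k π).card = k - 1 := by
  have h : greedyArms k π = (Finset.univ.filter fun i : Fin A => (i : ℕ) < k - 1).map
      π.toEmbedding := by
    ext a
    simp only [mem_greedyArms, Finset.mem_map_equiv, Finset.mem_filter, Finset.mem_univ, true_and]
  rw [h, Finset.card_map, Fin.card_filter_val_lt]
  omega

lemma card_compl_greedyArms {k : ℕ} (hk : 1 ≤ k) (hkA : k ≤ A) (π : Equiv.Perm (Fin A)) :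
    (((greedyArms k π)ᶜ).card : ℝ) = (A : ℝ) - k + 1 := by
  rw [Finset.card_compl, card_greedyArms hkA, Fintype.card_fin, Nat.cast_sub (by omega),
    Nat.cast_sub hk]
  push_cast
  ring

/-- The best arm outside of the greedy arms. -/
abbrev pivotArm (k : ℕ) (hk : 1 ≤ k) (hkA : k ≤ A) (π : Equiv.Perm (Fin A)) : Fin A :=
  π ⟨k - 1, by omega⟩

variable {k : ℕ} (hk : 1 ≤ k) (hkA : k ≤ A) {γ : ℝ} {y : Fin A → ℝ} {π : Equiv.Perm (Fin A)}

lemma pivotArm_mem : pivotArm k hk hkA π ∈ (greedyArms k π)ᶜ := by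
  simp [mem_greedyArms]

lemma le_pivotArm (hπ : IsRanking y π) {a : Fin A} (ha : a ∈ (greedyArms k π)ᶜ) :
    y a ≤ y (pivotArm k hk hkA π) := by
  have h : (⟨k - 1, by omega⟩ : Fin A) ≤ π.symm a := by
    rw [Finset.mem_compl, mem_greedyArms, not_lt] at ha
    exact ha
  simpa using hπ h

lemma pivotArm_le (hπ : IsRanking y π) {a : Fin A} (ha : a ∈ greedyArms k π) :
    y (pivotArm k hk hkA π) ≤ y a := by
  have h : π.symm a ≤ (⟨k - 1, by omega⟩ : Fin A) := by
    rw [mem_greedyArms] at ha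
    exact ha.le
  simpa using hπ h

/-- The weights of a randomized choice of `k` arms: `q a` is the probability that the arm `a`
is chosen. -/
def IsFractional (k : ℕ) (q : Fin A → ℝ) : Prop :=
  (∀ a, 0 ≤ q a ∧ q a ≤ 1) ∧ ∑ a, q a = k

lemma isFractional_indicator {S : Finset (Fin A)} (hS : S.card = k) :
    IsFractional k fun a => if a ∈ S then (1 : ℝ) else 0 := by
  refine ⟨fun a => ?_, by simp [hS]⟩
  dsimp only
  split_ifs <;> norm_num

/-- The value of a fractional choice is at most the value of the first `k` arms of the ranking, and
the loss is at least the one due to the arms outside of the greedy ones. -/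
lemma IsFractional.sum_add_le (hπ : IsRanking y π) {q : Fin A → ℝ} (hq : IsFractional k q) :
    ∑ a, q a * y a + ∑ a ∈ (greedyArms k π)ᶜ, q a * (y (pivotArm k hk hkA π) - y a) ≤
      ∑ a ∈ greedyArms k π, y a + y (pivotArm k hk hkA π) := by
  set b := pivotArm k hk hkA π
  have h1 := Finset.sum_add_sum_compl (greedyArms k π) (fun a => q a * y a)
  have h2 := Finset.sum_add_sum_compl (greedyArms k π) q
  rw [hq.2] at h2
  have h3 : ∑ a ∈ (greedyArms k π)ᶜ, q a * (y b - y a) =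
      (∑ a ∈ (greedyArms k π)ᶜ, q a) * y b - ∑ a ∈ (greedyArms k π)ᶜ, q a * y a := by
    simp only [mul_sub, Finset.sum_sub_distrib, Finset.sum_mul]
  -- Mass that `q` withholds from a greedy arm loses at least the gap of that arm to `b`. Expanding
  -- this sum, with total mass `k` and `k - 1` greedy arms, gives the claim.
  have h4 : 0 ≤ ∑ a ∈ greedyArms k π, (1 - q a) * (y a - y b) :=
    Finset.sum_nonneg fun a ha => mul_nonneg (by linarith [(hq.1 a).2])
      (by linarith [pivotArm_le hk hkA hπ ha])
  have h5 : ∑ a ∈ greedyArms k π, (1 - q a) * (y a - y b) =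
      ∑ a ∈ greedyArms k π, y a - ((k : ℝ) - 1) * y b - ∑ a ∈ greedyArms k π, q a * y a +
        (∑ a ∈ greedyArms k π, q a) * y b := by
    have h6 : ((greedyArms k π).card : ℝ) = (k : ℝ) - 1 := by
      rw [card_greedyArms hkA, Nat.cast_sub hk, Nat.cast_one]
    simp only [sub_mul, mul_sub, Finset.sum_sub_distrib, Finset.sum_mul, one_mul,
      Finset.sum_const, nsmul_eq_mul, h6]
    ring
  have h7 : ∑ a ∈ (greedyArms k π)ᶜ, q a = k - ∑ a ∈ greedyArms k π, q a := by linarith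
  rw [h3, h7, ← h1]
  rw [h5] at h4
  linarith

lemma card_insert_greedyArms (hk : 1 ≤ k) (hkA : k ≤ A) {a : Fin A}
    (ha : a ∈ (greedyArms k π)ᶜ) : (insert a (greedyArms k π)).card = k := by
  rw [Finset.card_insert_of_notMem (Finset.mem_compl.1 ha), card_greedyArms hkA]
  omega

lemma sum_le_topValue {S : Finset (Fin A)} (hS : S.card = k) (g : Fin A → ℝ) :
    ∑ a ∈ S, g a ≤ topValue k g :=
  le_ciSup (f := fun S : {S : Finset (Fin A) // S.card = k} => ∑ a ∈ S.1, g a)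
    (Set.finite_range _).bddAbove ⟨S, hS⟩

lemma topValue_eq (hπ : IsRanking y π) :
    topValue k y = ∑ a ∈ greedyArms k π, y a + y (pivotArm k hk hkA π) := by
  have hb := pivotArm_mem hk hkA (π := π)
  have hc := card_insert_greedyArms hk hkA hb
  apply le_antisymm
  · have : Nonempty {S : Finset (Fin A) // S.card = k} := ⟨⟨_, hc⟩⟩
    refine ciSup_le fun S => ?_
    have h := (isFractional_indicator S.2).sum_add_le hk hkA hπ
    have h0 : 0 ≤ ∑ a ∈ (greedyArms k π)ᶜ, (if a ∈ S.1 then (1 : ℝ) else 0) *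
        (y (pivotArm k hk hkA π) - y a) :=
      Finset.sum_nonneg fun a ha => mul_nonneg (by split_ifs <;> norm_num)
        (by linarith [le_pivotArm hk hkA hπ ha])
    simp only [ite_mul, one_mul, zero_mul, Finset.sum_ite_mem, Finset.univ_inter] at h h0
    linarith
  · have := sum_le_topValue hc y
    rw [Finset.sum_insert (Finset.mem_compl.1 hb)] at this
    linarith

lemma exists_isRanking (y : Fin A → ℝ) : ∃ π, IsRanking y π := by
  refine ⟨Tuple.sort fun a => - y a, fun i j hij => ?_⟩
  have := Tuple.monotone_sort (fun a => - y a) hij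
  simpa using this

/-- The fractional relaxation is tight: the bound `IsFractional.sum_add_le` holds for all fractional
choices and is attained by a set. Hence the regret of a randomized policy is nonnegative in every
context. -/
lemma IsFractional.sum_le_topValue {q : Fin A → ℝ} (hk : 1 ≤ k) (hkA : k ≤ A)
    (hq : IsFractional k q) (y : Fin A → ℝ) :
    ∑ a, q a * y a ≤ topValue k y := by
  obtain ⟨π, hπ⟩ := exists_isRanking y
  have h := hq.sum_add_le hk hkA hπ
  have h0 : 0 ≤ ∑ a ∈ (greedyArms k π)ᶜ, q a * (y (pivotArm k hk hkA π) - y a) :=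
    Finset.sum_nonneg fun a ha => mul_nonneg (hq.1 a).1
      (by linarith [le_pivotArm hk hkA hπ ha])
  rw [topValue_eq hk hkA hπ]
  linarith

lemma topValue_nonneg (hk : 1 ≤ k) (hkA : k ≤ A) (hy : ∀ a, 0 ≤ y a) : 0 ≤ topValue k y := by
  obtain ⟨π, hπ⟩ := exists_isRanking y
  rw [topValue_eq hk hkA hπ]
  exact add_nonneg (Finset.sum_nonneg fun a _ => hy a) (hy _)

lemma topValue_le (hk : 1 ≤ k) (hkA : k ≤ A) (hy : ∀ a, y a ≤ 1) : topValue k y ≤ k := by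
  obtain ⟨π, hπ⟩ := exists_isRanking y
  have : Nonempty {S : Finset (Fin A) // S.card = k} :=
    ⟨⟨_, card_insert_greedyArms hk hkA (pivotArm_mem hk hkA (π := π))⟩⟩
  refine ciSup_le fun S => (Finset.sum_le_card_nsmul _ _ 1 fun a _ => hy a).trans ?_
  simp [S.2]

/-! ### Inverse gap weighting -/

section InverseGapWeighting

variable {s : Finset (Fin A)} {b : Fin A}

lemma sum_igw (hb : b ∈ s) : ∑ a ∈ s, igw γ s y b a = 1 := by
  rw [← Finset.add_sum_erase s _ hb]
  have h : ∑ a ∈ s.erase b, igw γ s y b a =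
      ∑ a' ∈ s.erase b, 1 / ((s.card : ℝ) + γ * (y b - y a')) := by
    refine Finset.sum_congr rfl fun a ha => ?_
    simp [igw, Finset.ne_of_mem_erase ha, Finset.mem_of_mem_erase ha]
  rw [h]
  simp [igw, hb]

/-- Only `a = b` needs an argument: `b` receives the remaining mass, and as each of the other
`s.card - 1` arms takes at most `1 / s.card`, at least `1 / s.card` remains. -/
lemma le_igw (hγ : 0 ≤ γ) (hb : b ∈ s) (hy : ∀ a ∈ s, y a ≤ y b) {a : Fin A} (ha : a ∈ s) :
    1 / ((s.card : ℝ) + γ * (y b - y a)) ≤ igw γ s y b a := by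
  by_cases hab : a = b
  · subst hab
    have hs : (0 : ℝ) < s.card := by exact_mod_cast Finset.card_pos.2 ⟨a, ha⟩
    have h : ∑ a' ∈ s.erase a, 1 / ((s.card : ℝ) + γ * (y a - y a')) ≤
        ∑ a' ∈ s.erase a, 1 / (s.card : ℝ) := by
      refine Finset.sum_le_sum fun a' ha' => one_div_le_one_div_of_le hs ?_
      have := mul_nonneg hγ (sub_nonneg.2 (hy a' (Finset.mem_of_mem_erase ha')))
      linarith
    rw [Finset.sum_const, Finset.card_erase_of_mem ha, nsmul_eq_mul,
      Nat.cast_sub (Finset.card_pos.2 ⟨a, ha⟩)] at h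
    have h' : ((s.card : ℝ) - (1 : ℕ)) * (1 / s.card) = 1 - 1 / s.card := by
      field_simp
      simp
    simp only [igw, ha, not_true_eq_false, if_false, if_true, sub_self, mul_zero, add_zero]
    linarith
  · simp [igw, ha, hab]

lemma card_add_pos (hγ : 0 ≤ γ) (hy : ∀ a ∈ s, y a ≤ y b) {a : Fin A} (ha : a ∈ s) :
    0 < (s.card : ℝ) + γ * (y b - y a) := by
  have hs : (0 : ℝ) < s.card := by exact_mod_cast Finset.card_pos.2 ⟨a, ha⟩
  have := mul_nonneg hγ (sub_nonneg.2 (hy a ha))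
  linarith

lemma igw_pos (hγ : 0 ≤ γ) (hb : b ∈ s) (hy : ∀ a ∈ s, y a ≤ y b) {a : Fin A} (ha : a ∈ s) :
    0 < igw γ s y b a :=
  (one_div_pos.2 (card_add_pos hγ hy ha)).trans_le (le_igw hγ hb hy ha)

/-- With `x = γ * (y b - y a)` the left side is `x / (s.card + x)`, and it vanishes at `b`. So each
arm costs at most `1 / γ`, however large its gap. -/
lemma mul_igw_le (hγ : 0 ≤ γ) (hy : ∀ a ∈ s, y a ≤ y b) {a : Fin A} (ha : a ∈ s) :
    γ * (igw γ s y b a * (y b - y a)) ≤ 1 := by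
  by_cases hab : a = b
  · subst hab; simp
  · have h := card_add_pos hγ hy ha
    simp only [igw, ha, hab, not_true_eq_false, if_false]
    rw [show γ * (1 / ((s.card : ℝ) + γ * (y b - y a)) * (y b - y a)) =
      (γ * (y b - y a)) / ((s.card : ℝ) + γ * (y b - y a)) by ring, div_le_one h]
    linarith [(Nat.cast_nonneg s.card : (0 : ℝ) ≤ s.card)]

end InverseGapWeighting

/-! ### Inclusion probabilities of the algorithm -/

/-- The probability that the arm `a` is among the arms chosen by the algorithm. -/
noncomputable def inclusionProb (k : ℕ) (hk : 1 ≤ k) (hkA : k ≤ A) (γ : ℝ) (y : Fin A → ℝ)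
    (π : Equiv.Perm (Fin A)) (a : Fin A) : ℝ :=
  if a ∈ greedyArms k π then 1 else igw γ (greedyArms k π)ᶜ y (pivotArm k hk hkA π) a

lemma sum_selectionProb_mul (φ : Finset (Fin A) → ℝ) :
    ∑ S, selectionProb k hk hkA γ y π S * φ S =
      ∑ a ∈ (greedyArms k π)ᶜ, igw γ (greedyArms k π)ᶜ y (pivotArm k hk hkA π) a *
        φ (insert a (greedyArms k π)) := by
  simp only [selectionProb, Finset.sum_mul]
  rw [Finset.sum_comm]
  refine Finset.sum_congr rfl fun a _ => ?_
  simp [ite_mul]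

lemma sum_inclusionProb_mul (g : Fin A → ℝ) :
    ∑ a, inclusionProb k hk hkA γ y π a * g a = ∑ a ∈ greedyArms k π, g a +
      ∑ a ∈ (greedyArms k π)ᶜ, igw γ (greedyArms k π)ᶜ y (pivotArm k hk hkA π) a * g a := by
  rw [← Finset.sum_add_sum_compl (greedyArms k π)]
  congr 1
  · exact Finset.sum_congr rfl fun a ha => by simp [inclusionProb, ha]
  · exact Finset.sum_congr rfl fun a ha => by simp [inclusionProb, Finset.mem_compl.1 ha]

/-- Every possible set contains the greedy arms, and the weights of the extra arm sum to one. This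
is the passage from the law of the chosen set to inclusion probabilities. -/
lemma sum_selectionProb_mul_sum (g : Fin A → ℝ) :
    ∑ S, selectionProb k hk hkA γ y π S * ∑ a ∈ S, g a =
      ∑ a, inclusionProb k hk hkA γ y π a * g a := by
  rw [sum_selectionProb_mul, sum_inclusionProb_mul]
  have h : ∀ a ∈ (greedyArms k π)ᶜ, igw γ (greedyArms k π)ᶜ y (pivotArm k hk hkA π) a *
      ∑ a ∈ insert a (greedyArms k π), g a =
      igw γ (greedyArms k π)ᶜ y (pivotArm k hk hkA π) a * ∑ a ∈ greedyArms k π, g a +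
      igw γ (greedyArms k π)ᶜ y (pivotArm k hk hkA π) a * g a := fun a ha => by
    rw [Finset.sum_insert (Finset.mem_compl.1 ha)]
    ring
  rw [Finset.sum_congr rfl h, Finset.sum_add_distrib, ← Finset.sum_mul,
    sum_igw (pivotArm_mem hk hkA), one_mul]

lemma sum_selectionProb : ∑ S, selectionProb k hk hkA γ y π S = 1 := by
  have h := sum_selectionProb_mul hk hkA (γ := γ) (y := y) (π := π) fun _ => 1
  simp only [mul_one] at h
  rw [h, sum_igw (pivotArm_mem hk hkA)]

lemma inclusionProb_pos (hγ : 0 ≤ γ) (hπ : IsRanking y π) (a : Fin A) :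
    0 < inclusionProb k hk hkA γ y π a := by
  have hy : ∀ a ∈ (greedyArms k π)ᶜ, y a ≤ y (pivotArm k hk hkA π) :=
    fun a ha => le_pivotArm hk hkA hπ ha
  unfold inclusionProb
  split_ifs with ha
  · exact one_pos
  · exact igw_pos hγ (pivotArm_mem hk hkA) hy (Finset.mem_compl.2 ha)

lemma isFractional_inclusionProb (hγ : 0 ≤ γ) (hπ : IsRanking y π) :
    IsFractional k (inclusionProb k hk hkA γ y π) := by
  have hy : ∀ a ∈ (greedyArms k π)ᶜ, y a ≤ y (pivotArm k hk hkA π) :=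
    fun a ha => le_pivotArm hk hkA hπ ha
  refine ⟨fun a => ⟨(inclusionProb_pos hk hkA hγ hπ a).le, ?_⟩, ?_⟩
  · unfold inclusionProb
    split_ifs with ha
    · exact le_rfl
    · rw [← sum_igw (γ := γ) (y := y) (pivotArm_mem hk hkA (π := π))]
      exact Finset.single_le_sum
        (f := fun a => igw γ (greedyArms k π)ᶜ y (pivotArm k hk hkA π) a)
        (fun a ha => (igw_pos hγ (pivotArm_mem hk hkA) hy ha).le) (Finset.mem_compl.2 ha)
  · have h := sum_inclusionProb_mul hk hkA (γ := γ) (y := y) (π := π) fun _ => 1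
    simp only [mul_one] at h
    rw [h, sum_igw (pivotArm_mem hk hkA)]
    simp only [Finset.sum_const, card_greedyArms hkA, nsmul_eq_mul, mul_one]
    rw [Nat.cast_sub hk]
    simp

/-- The loss of inverse gap weighting, measured by the scores that it uses. -/
lemma mul_topValue_sub_le (hγ : 0 ≤ γ) (hπ : IsRanking y π) :
    γ * (topValue k y - ∑ a, inclusionProb k hk hkA γ y π a * y a) ≤ (A : ℝ) - k + 1 := by
  set b := pivotArm k hk hkA π
  have h1 : topValue k y - ∑ a, inclusionProb k hk hkA γ y π a * y a =
      ∑ a ∈ (greedyArms k π)ᶜ, igw γ (greedyArms k π)ᶜ y b a * (y b - y a) := by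
    rw [topValue_eq hk hkA hπ, sum_inclusionProb_mul]
    simp only [mul_sub, Finset.sum_sub_distrib, ← Finset.sum_mul]
    rw [sum_igw (pivotArm_mem hk hkA)]
    ring
  have hy : ∀ a ∈ (greedyArms k π)ᶜ, y a ≤ y b := fun a ha => le_pivotArm hk hkA hπ ha
  rw [h1, Finset.mul_sum, ← card_compl_greedyArms hk hkA π]
  refine (Finset.sum_le_card_nsmul _ _ 1 fun a ha =>
    mul_igw_le hγ hy ha).trans ?_
  simp

/-- A change of measure from a fractional choice `q` to the choice of the algorithm. -/
lemma IsFractional.sum_mul_abs_le (hγ : 0 ≤ γ) (hπ : IsRanking y π) {q : Fin A → ℝ}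
    (hq : IsFractional k q) {g : ℝ} (hg : 0 < g) (d : Fin A → ℝ) :
    ∑ a, q a * |d a| ≤ 1 / (8 * g) * (k * ((A : ℝ) - k + 1) +
      γ * (topValue k y - ∑ a, q a * y a)) +
        2 * g * ∑ a, inclusionProb k hk hkA γ y π a * d a ^ 2 := by
  set b := pivotArm k hk hkA π
  set m : ℝ := (A : ℝ) - k + 1
  have hm : 1 ≤ m := by
    have : (k : ℝ) ≤ A := by exact_mod_cast hkA
    simp only [m]; linarith
  -- `w a` bounds the inverse inclusion probability. For greedy arms 1 would suffice; taking `m`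
  -- there too makes the constant part of `∑ a, q a * w a` equal to `k * m`.
  have hw : ∀ a, ∃ w : ℝ, w = if a ∈ greedyArms k π then m else m + γ * (y b - y a) :=
    fun a => ⟨_, rfl⟩
  choose w hw using hw
  have hwp : ∀ a, 1 ≤ w a * inclusionProb k hk hkA γ y π a := by
    intro a
    rw [hw]
    unfold inclusionProb
    split_ifs with ha
    · linarith
    · have ha' := Finset.mem_compl.2 ha
      have hy : ∀ a ∈ (greedyArms k π)ᶜ, y a ≤ y b := fun a ha => le_pivotArm hk hkA hπ ha
      have h1 := le_igw hγ (pivotArm_mem hk hkA (π := π)) hy ha'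
      have h2 := card_add_pos hγ hy ha'
      rw [card_compl_greedyArms hk hkA] at h1 h2
      rwa [div_le_iff₀' h2] at h1
  have hterm : ∀ a, q a * |d a| ≤ 1 / (8 * g) * (q a * w a) +
      2 * g * (inclusionProb k hk hkA γ y π a * d a ^ 2) := by
    intro a
    have hp := inclusionProb_pos hk hkA hγ hπ a
    set p := inclusionProb k hk hkA γ y π a
    have hq0 := (hq.1 a).1
    have hq1 := (hq.1 a).2
    have h1 : |d a| ≤ 1 / (8 * g) * w a + 2 * g * (p * d a ^ 2) := by
      have h2 : 1 / p ≤ w a := by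
        rw [div_le_iff₀ hp]; exact hwp a
      have h3 : |d a| ≤ 1 / (8 * g) * (1 / p) + 2 * g * (p * d a ^ 2) := by
        rw [← sq_abs (d a)]
        -- The inequality of arithmetic and geometric means, as a completed square.
        have : 1 / (8 * g) * (1 / p) + 2 * g * (p * |d a| ^ 2) - |d a| =
          (1 - 4 * g * p * |d a|) ^ 2 / (8 * g * p) := by
          field_simp
          ring
        have h0 : 0 ≤ (1 - 4 * g * p * |d a|) ^ 2 / (8 * g * p) := by positivity
        linarith
      have := mul_le_mul_of_nonneg_left h2 (show 0 ≤ 1 / (8 * g) by positivity)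
      linarith
    -- Since `q a ≤ 1`, the factor `q a` may be dropped from the quadratic term and kept only on `w
    -- a`.
    have h4 : 0 ≤ 2 * g * (p * d a ^ 2) := by positivity
    have h5 := mul_le_mul_of_nonneg_left h1 hq0
    nlinarith
  have hsum : ∑ a, q a * w a ≤ k * m + γ * (topValue k y - ∑ a, q a * y a) := by
    have h1 := hq.sum_add_le hk hkA hπ
    rw [← topValue_eq hk hkA hπ] at h1
    have h2 : ∑ a, q a * w a =
        k * m + γ * ∑ a ∈ (greedyArms k π)ᶜ, q a * (y b - y a) := by
      rw [← hq.2, Finset.sum_mul, Finset.mul_sum, ← Finset.sum_add_sum_compl (greedyArms k π),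
        ← Finset.sum_add_sum_compl (greedyArms k π) (fun a => q a * m), add_assoc,
        ← Finset.sum_add_distrib]
      congr 1
      · exact Finset.sum_congr rfl fun a ha => by simp [hw, ha]
      · refine Finset.sum_congr rfl fun a ha => ?_
        simp only [hw, Finset.mem_compl.1 ha, if_false]
        ring
    rw [h2]
    have := mul_le_mul_of_nonneg_left h1 hγ
    linarith
  calc ∑ a, q a * |d a| ≤ ∑ a, (1 / (8 * g) * (q a * w a) +
      2 * g * (inclusionProb k hk hkA γ y π a * d a ^ 2)) := Finset.sum_le_sum fun a _ => hterm a
    _ = 1 / (8 * g) * ∑ a, q a * w a +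
      2 * g * ∑ a, inclusionProb k hk hkA γ y π a * d a ^ 2 := by
        rw [Finset.sum_add_distrib, Finset.mul_sum, Finset.mul_sum]
    _ ≤ _ := by
        have := mul_le_mul_of_nonneg_left hsum (show 0 ≤ 1 / (8 * g) by positivity)
        linarith

/-! ### Policies, and the comparison of true and estimated regret -/

section Policies

variable {X : Type*} [MeasurableSpace X] {A k : ℕ}

/-- A randomized policy: in the context `x` the arm `a` is chosen with probability `q x a`. -/
structure IsPolicy (k : ℕ) (q : X → Fin A → ℝ) : Prop where
  measurable : ∀ a, Measurable fun x => q x a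
  fractional : ∀ x, IsFractional k (q x)

/-- The regret of the policy `q` when the mean rewards are given by `f`. -/
noncomputable def policyRegret (μ : Measure X) (k : ℕ) (f q : X → Fin A → ℝ) : ℝ :=
  ∫ x, (topValue k (f x) - ∑ a, q x a * f x a) ∂μ

/-- `f` is measurable with values in `[0, 1]`. -/
def IsUnitValued (f : X → Fin A → ℝ) : Prop :=
  ∀ a, Measurable (fun x => f x a) ∧ ∀ x, f x a ∈ Set.Icc (0 : ℝ) 1

lemma measurable_topValue {f : X → Fin A → ℝ} (hf : IsUnitValued f) :
    Measurable fun x => topValue k (f x) :=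
  Measurable.iSup fun _ => Finset.measurable_sum _ fun a _ => (hf a).1

lemma IsPolicy.gap_mem (hk : 1 ≤ k) (hkA : k ≤ A) {f q : X → Fin A → ℝ} (hf : IsUnitValued f)
    (hq : IsPolicy k q) (x : X) :
    topValue k (f x) - ∑ a, q x a * f x a ∈ Set.Icc (0 : ℝ) k := by
  refine ⟨sub_nonneg.2 ((hq.fractional x).sum_le_topValue hk hkA _), ?_⟩
  have h1 := topValue_le hk hkA fun a => ((hf a).2 x).2
  have h2 : 0 ≤ ∑ a, q x a * f x a :=
    Finset.sum_nonneg fun a _ => mul_nonneg ((hq.fractional x).1 a).1 ((hf a).2 x).1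
  linarith

lemma IsPolicy.measurable_sum {q d : X → Fin A → ℝ} (hq : IsPolicy k q)
    (hd : ∀ a, Measurable fun x => d x a) : Measurable fun x => ∑ a, q x a * d x a :=
  Finset.measurable_sum _ fun a _ => (hq.measurable a).mul (hd a)

lemma IsPolicy.integrable_sum (μ : Measure X) [IsFiniteMeasure μ] {q d : X → Fin A → ℝ}
    (hq : IsPolicy k q) (hd : ∀ a, Measurable fun x => d x a) (hd1 : ∀ x a, |d x a| ≤ 1) :
    Integrable (fun x => ∑ a, q x a * d x a) μ := by
  refine Integrable.of_bound (hq.measurable_sum hd).aestronglyMeasurable k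
    (Filter.Eventually.of_forall fun x => ?_)
  rw [← (hq.fractional x).2]
  refine (norm_sum_le _ _).trans (Finset.sum_le_sum fun a _ => ?_)
  rw [norm_mul, Real.norm_of_nonneg ((hq.fractional x).1 a).1]
  exact mul_le_of_le_one_right ((hq.fractional x).1 a).1 (hd1 x a)

lemma IsPolicy.integrable_gap (μ : Measure X) [IsFiniteMeasure μ] (hk : 1 ≤ k) (hkA : k ≤ A)
    {f q : X → Fin A → ℝ} (hf : IsUnitValued f) (hq : IsPolicy k q) :
    Integrable (fun x => topValue k (f x) - ∑ a, q x a * f x a) μ := by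
  refine Integrable.of_bound ((measurable_topValue hf).sub
    (hq.measurable_sum fun a => (hf a).1)).aestronglyMeasurable k
    (Filter.Eventually.of_forall fun x => ?_)
  have := hq.gap_mem hk hkA hf x
  rw [Real.norm_of_nonneg this.1]
  exact this.2

lemma policyRegret_nonneg (μ : Measure X) (hk : 1 ≤ k) (hkA : k ≤ A) {f q : X → Fin A → ℝ}
    (hf : IsUnitValued f) (hq : IsPolicy k q) : 0 ≤ policyRegret μ k f q :=
  integral_nonneg fun x => (hq.gap_mem hk hkA hf x).1

lemma policyRegret_le (μ : Measure X) [IsProbabilityMeasure μ] (hk : 1 ≤ k) (hkA : k ≤ A)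
    {f q : X → Fin A → ℝ} (hf : IsUnitValued f) (hq : IsPolicy k q) :
    policyRegret μ k f q ≤ k := by
  have := integral_mono (hq.integrable_gap μ hk hkA hf) (integrable_const (k : ℝ))
    fun x => (hq.gap_mem hk hkA hf x).2
  simpa [policyRegret] using this

lemma abs_sub_le_one_of_isUnitValued {f g : X → Fin A → ℝ} (hf : IsUnitValued f)
    (hg : IsUnitValued g) (x : X) (a : Fin A) : |f x a - g x a| ≤ 1 := by
  have h1 := (hf a).2 x
  have h2 := (hg a).2 x
  rw [abs_le]
  constructor <;> linarith [h1.1, h1.2, h2.1, h2.2]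

section Ranked

variable {f : X → Fin A → ℝ} {ρ : X → Equiv.Perm (Fin A)}

lemma measurable_comp_rank (hρ : ∀ π, MeasurableSet {x | ρ x = π})
    {φ : Equiv.Perm (Fin A) → X → ℝ} (hφ : ∀ π, Measurable (φ π)) :
    Measurable fun x => φ (ρ x) x := by
  have h : (fun x => φ (ρ x) x) = fun x => ∑ π, {x | ρ x = π}.indicator (φ π) x := by
    funext x
    rw [Finset.sum_eq_single (ρ x)]
    · simp
    · intro π _ hπ
      simp [Ne.symm hπ]
    · simp
  rw [h]
  exact Finset.measurable_sum _ fun π _ => (hφ π).indicator (hρ π)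

lemma measurable_igw (hf : IsUnitValued f) (γ : ℝ) (s : Finset (Fin A)) (b a : Fin A) :
    Measurable fun x => igw γ s (f x) b a := by
  unfold igw
  have h := fun a => (hf a).1
  split_ifs
  · fun_prop
  · fun_prop
  · fun_prop

/-- The policy of the algorithm with scores `f`. -/
noncomputable def explorePolicy (k : ℕ) (hk : 1 ≤ k) (hkA : k ≤ A) (γ : ℝ) (f : X → Fin A → ℝ)
    (ρ : X → Equiv.Perm (Fin A)) (x : X) (a : Fin A) : ℝ :=
  inclusionProb k hk hkA γ (f x) (ρ x) a

/-- The policy that takes the first `k` arms. -/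
noncomputable def greedyPolicy (k : ℕ) (hk : 1 ≤ k) (hkA : k ≤ A) (ρ : X → Equiv.Perm (Fin A))
    (x : X) (a : Fin A) : ℝ :=
  if a ∈ insert (pivotArm k hk hkA (ρ x)) (greedyArms k (ρ x)) then 1 else 0

variable (hk : 1 ≤ k) (hkA : k ≤ A)

lemma isPolicy_explorePolicy {γ : ℝ} (hγ : 0 ≤ γ) (hf : IsUnitValued f)
    (hρ : ∀ π, MeasurableSet {x | ρ x = π}) (hr : ∀ x, IsRanking (f x) (ρ x)) :
    IsPolicy k (explorePolicy k hk hkA γ f ρ) := by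
  refine ⟨fun a => measurable_comp_rank hρ
    (φ := fun π x => inclusionProb k hk hkA γ (f x) π a) fun π => ?_,
    fun x => isFractional_inclusionProb hk hkA hγ (hr x)⟩
  unfold inclusionProb
  split_ifs
  · exact measurable_const
  · exact measurable_igw hf _ _ _ _

lemma isPolicy_greedyPolicy (hρ : ∀ π, MeasurableSet {x | ρ x = π}) :
    IsPolicy k (greedyPolicy k hk hkA ρ) := by
  refine ⟨fun a => measurable_comp_rank hρ (φ := fun π _ =>
    if a ∈ insert (pivotArm k hk hkA π) (greedyArms k π) then 1 else 0) fun π =>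
    measurable_const, fun x => isFractional_indicator
      (card_insert_greedyArms hk hkA (pivotArm_mem hk hkA))⟩

lemma policyRegret_greedyPolicy (μ : Measure X) (hr : ∀ x, IsRanking (f x) (ρ x)) :
    policyRegret μ k f (greedyPolicy k hk hkA ρ) = 0 := by
  have h : ∀ x, topValue k (f x) - ∑ a, greedyPolicy k hk hkA ρ x a * f x a = 0 := by
    intro x
    rw [topValue_eq hk hkA (hr x)]
    simp only [greedyPolicy, ite_mul, one_mul, zero_mul, Finset.sum_ite_mem, Finset.univ_inter]
    rw [Finset.sum_insert (Finset.mem_compl.1 (pivotArm_mem hk hkA))]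
    ring
  simp [policyRegret, h]

lemma mul_policyRegret_explorePolicy_le (μ : Measure X) [IsProbabilityMeasure μ] {γ : ℝ}
    (hγ : 0 ≤ γ) (hf : IsUnitValued f) (hρ : ∀ π, MeasurableSet {x | ρ x = π})
    (hr : ∀ x, IsRanking (f x) (ρ x)) :
    γ * policyRegret μ k f (explorePolicy k hk hkA γ f ρ) ≤ (A : ℝ) - k + 1 := by
  have h := integral_mono (((isPolicy_explorePolicy hk hkA hγ hf hρ hr).integrable_gap μ hk hkA
    hf).const_mul γ) (integrable_const ((A : ℝ) - k + 1))
    fun x => mul_topValue_sub_le hk hkA hγ (hr x)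
  rw [integral_const_mul] at h
  simpa [policyRegret] using h

/-- The mean squared deviation of `g` from `h` on the arms that are chosen by the policy `q`. -/
noncomputable def policyError (μ : Measure X) (q g h : X → Fin A → ℝ) : ℝ :=
  ∫ x, ∑ a, q x a * (g x a - h x a) ^ 2 ∂μ

/-- A change of measure from the policy `q` to the policy of the algorithm. -/
lemma integral_sum_mul_abs_le (μ : Measure X) [IsProbabilityMeasure μ] {γ : ℝ}
    (hγ : 0 ≤ γ) (hf : IsUnitValued f) (hρ : ∀ π, MeasurableSet {x | ρ x = π})
    (hr : ∀ x, IsRanking (f x) (ρ x)) {q g h : X → Fin A → ℝ} (hq : IsPolicy k q)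
    (hg : IsUnitValued g) (hh : IsUnitValued h) {s : ℝ} (hs : 0 < s) :
    ∫ x, ∑ a, q x a * |g x a - h x a| ∂μ ≤
      1 / (8 * s) * (k * ((A : ℝ) - k + 1) + γ * policyRegret μ k f q) +
        2 * s * policyError μ (explorePolicy k hk hkA γ f ρ) g h := by
  have hp := isPolicy_explorePolicy hk hkA hγ hf hρ hr
  have hd := abs_sub_le_one_of_isUnitValued hg hh
  have hm : ∀ a, Measurable fun x => g x a - h x a := fun a => (hg a).1.sub (hh a).1
  have i1 : Integrable (fun x => ∑ a, q x a * |g x a - h x a|) μ :=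
    hq.integrable_sum μ (fun a => (hm a).abs) fun x a => by rw [abs_abs]; exact hd x a
  have i2 : Integrable (fun x => ∑ a, explorePolicy k hk hkA γ f ρ x a *
      (g x a - h x a) ^ 2) μ :=
    hp.integrable_sum μ (fun a => (hm a).pow_const 2) fun x a => by
      rw [abs_pow]
      exact pow_le_one₀ (abs_nonneg _) (hd x a)
  have i3 := hq.integrable_gap μ hk hkA hf
  have i4 := ((integrable_const (μ := μ) (k * ((A : ℝ) - k + 1))).add
    (i3.const_mul γ)).const_mul (1 / (8 * s))
  refine (integral_mono i1 (i4.add (i2.const_mul (2 * s))) fun x =>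
    (hq.fractional x).sum_mul_abs_le hk hkA hγ (hr x) hs _).trans_eq ?_
  rw [integral_add' i4 (i2.const_mul _), integral_const_mul, integral_const_mul]
  simp only [Pi.add_apply]
  rw [integral_add (integrable_const _) (i3.const_mul γ), integral_const_mul (μ := μ) γ]
  simp [policyRegret, policyError]

end Ranked

/-- The policy `q₀` is optimal for `g` and at most optimal for `h`. So replacing `g` by `h` changes
the benchmark by no more than the deviation under `q₀`, and the value of `q` by no more than the
deviation under `q`. -/
lemma policyRegret_sub_policyRegret (μ : Measure X) [IsProbabilityMeasure μ] (hk : 1 ≤ k)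
    (hkA : k ≤ A) {g h q₀ q : X → Fin A → ℝ} (hg : IsUnitValued g) (hh : IsUnitValued h)
    (hq₀ : IsPolicy k q₀) (hq : IsPolicy k q) (h0 : policyRegret μ k g q₀ = 0) :
    policyRegret μ k g q - policyRegret μ k h q ≤
      ∫ x, ∑ a, q₀ x a * |g x a - h x a| ∂μ + ∫ x, ∑ a, q x a * |g x a - h x a| ∂μ := by
  have hd := abs_sub_le_one_of_isUnitValued hg hh
  have hm : ∀ a, Measurable fun x => |g x a - h x a| := fun a => ((hg a).1.sub (hh a).1).abs
  have hd' : ∀ x a, |(|g x a - h x a|)| ≤ 1 := fun x a => by rw [abs_abs]; exact hd x a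
  have i1 := hq₀.integrable_sum μ hm hd'
  have i2 := hq.integrable_sum μ hm hd'
  have j1 := hq.integrable_gap μ hk hkA hg
  have j2 := hq.integrable_gap μ hk hkA hh
  have j3 := hq₀.integrable_gap μ hk hkA hg
  rw [← sub_zero (policyRegret μ k g q - _), ← h0]
  unfold policyRegret
  rw [← integral_sub' j1 j2, ← integral_sub' (j1.sub j2) j3, ← integral_add i1 i2]
  refine integral_mono ((j1.sub j2).sub j3) (i1.add i2) fun x => ?_
  have h1 := (hq₀.fractional x).sum_le_topValue hk hkA (h x)
  have h2 : ∑ a, q₀ x a * g x a - ∑ a, q₀ x a * h x a ≤ ∑ a, q₀ x a * |g x a - h x a| := by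
    rw [← Finset.sum_sub_distrib]
    refine Finset.sum_le_sum fun a _ => ?_
    rw [← mul_sub]
    exact mul_le_mul_of_nonneg_left (le_abs_self _) ((hq₀.fractional x).1 a).1
  have h3 : ∑ a, q x a * h x a - ∑ a, q x a * g x a ≤ ∑ a, q x a * |g x a - h x a| := by
    rw [← Finset.sum_sub_distrib]
    refine Finset.sum_le_sum fun a _ => ?_
    rw [← mul_sub, abs_sub_comm]
    exact mul_le_mul_of_nonneg_left (le_abs_self _) ((hq.fractional x).1 a).1
  simp only [Pi.sub_apply]
  linarith

/-- The regret with respect to the estimate of an epoch is comparable to the true regret, if this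
holds for the estimate of an earlier epoch whose policy controls the error of the estimate. -/
lemma policyRegret_comparison (μ : Measure X) [IsProbabilityMeasure μ] (hk : 1 ≤ k)
    (hkA : k ≤ A) {𝓕 : Finset (X → Fin A → ℝ)} (h𝓕 : ∀ f ∈ 𝓕, IsUnitValued f)
    {rank : (X → Fin A → ℝ) → X → Equiv.Perm (Fin A)}
    (hr : ∀ f ∈ 𝓕, ∀ x, IsRanking (f x) (rank f x))
    (hρ : ∀ f ∈ 𝓕, ∀ π, MeasurableSet {x | rank f x = π})
    {fstar f g : X → Fin A → ℝ} (hstar : fstar ∈ 𝓕) (hf : f ∈ 𝓕) (hg : g ∈ 𝓕)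
    {γ s : ℝ} (hγ : 0 ≤ γ) (hγs : γ ≤ s) (hs : 0 < s)
    (herr : policyError μ (explorePolicy k hk hkA γ f (rank f)) g fstar ≤
      k * ((A : ℝ) - k + 1) / s ^ 2)
    (hprev : ∀ q, IsPolicy k q → γ * policyRegret μ k f q ≤
      2 * γ * policyRegret μ k fstar q + 9 * (k * ((A : ℝ) - k + 1)))
    {q : X → Fin A → ℝ} (hq : IsPolicy k q) :
    s * policyRegret μ k fstar q ≤
        2 * s * policyRegret μ k g q + 9 * (k * ((A : ℝ) - k + 1)) ∧
      s * policyRegret μ k g q ≤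
        2 * s * policyRegret μ k fstar q + 9 * (k * ((A : ℝ) - k + 1)) := by
  set K : ℝ := k * ((A : ℝ) - k + 1)
  have hK : 0 ≤ K := by
    have : (k : ℝ) ≤ A := by exact_mod_cast hkA
    exact mul_nonneg (Nat.cast_nonneg k) (by linarith)
  -- The change of measure gives `(K + γ * policyRegret μ k f q) / 8 + 2 * K`. By `hprev` and `γ ≤
  -- s` the constant is `(1 + 9) / 8 + 2 = 13 / 4`, and the regret has coefficient `2 / 8`.
  have err : ∀ q, IsPolicy k q → s * ∫ x, ∑ a, q x a * |g x a - fstar x a| ∂μ ≤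
      s * policyRegret μ k fstar q / 4 + 13 / 4 * K := by
    intro q hq
    have h1 := integral_sum_mul_abs_le hk hkA μ hγ (h𝓕 f hf) (hρ f hf) (hr f hf) hq (h𝓕 g hg)
      (h𝓕 fstar hstar) hs
    have h2 := hprev q hq
    have h3 := mul_le_mul_of_nonneg_right hγs (policyRegret_nonneg μ hk hkA (h𝓕 fstar hstar) hq)
    have h4 := mul_le_mul_of_nonneg_left h1 hs.le
    have h5 : s * (1 / (8 * s) * (K + γ * policyRegret μ k f q) +
        2 * s * policyError μ (explorePolicy k hk hkA γ f (rank f)) g fstar) =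
        1 / 8 * (K + γ * policyRegret μ k f q) +
        2 * (policyError μ (explorePolicy k hk hkA γ f (rank f)) g fstar * s ^ 2) := by
      field_simp
    rw [le_div_iff₀ (by positivity)] at herr
    rw [h5] at h4
    linarith
  have hcomm : ∀ q : X → Fin A → ℝ, ∫ x, ∑ a, q x a * |fstar x a - g x a| ∂μ =
      ∫ x, ∑ a, q x a * |g x a - fstar x a| ∂μ := fun q => by simp only [abs_sub_comm]
  -- The benchmark is the greedy policy of `fstar`, whose true regret is zero, so only the errors
  -- `13 / 4 * K` (twice) and a quarter of the regret of `q` occur; the latter is absorbed on the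
  -- left.
  have lower : ∀ q, IsPolicy k q →
      3 / 4 * (s * policyRegret μ k fstar q) ≤ s * policyRegret μ k g q + 13 / 2 * K := by
    intro q hq
    have hg0 := policyRegret_greedyPolicy hk hkA μ (hr fstar hstar)
    have hgp := isPolicy_greedyPolicy hk hkA (hρ fstar hstar)
    have h1 := policyRegret_sub_policyRegret μ hk hkA (h𝓕 fstar hstar) (h𝓕 g hg) hgp hq hg0
    rw [hcomm, hcomm] at h1
    have h2 := err _ hgp
    have h3 := err q hq
    rw [hg0] at h2
    nlinarith
  have hg0 := policyRegret_greedyPolicy hk hkA μ (hr g hg)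
  have hgp := isPolicy_greedyPolicy hk hkA (hρ g hg)
  have h1 := policyRegret_sub_policyRegret μ hk hkA (h𝓕 g hg) (h𝓕 fstar hstar) hgp hq hg0
  have h2 := err _ hgp
  have h3 := err q hq
  -- For the converse the benchmark is the greedy policy of `g`. Its true regret need not vanish,
  -- but the direction already proved bounds `s` times it by `26 / 3 * K`; both final constants are
  -- then `26 / 3 ≤ 9`.
  have h4 := lower _ hgp
  have h5 := mul_le_mul_of_nonneg_left h1 hs.le
  have h6 := lower q hq
  have h7 := mul_nonneg hs.le (policyRegret_nonneg μ hk hkA (h𝓕 fstar hstar) hq)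
  have h8 := mul_nonneg hs.le (policyRegret_nonneg μ hk hkA (h𝓕 g hg) hq)
  rw [hg0] at h4
  constructor
  · linarith
  · linarith

/-- The regret of the policies of the algorithm, if the error of each estimate is controlled by the
policy of some earlier epoch. -/
lemma mul_policyRegret_le_of_policyError_le (μ : Measure X) [IsProbabilityMeasure μ] (hk : 1 ≤ k)
    (hkA : k ≤ A) {𝓕 : Finset (X → Fin A → ℝ)} (h𝓕 : ∀ f ∈ 𝓕, IsUnitValued f)
    {rank : (X → Fin A → ℝ) → X → Equiv.Perm (Fin A)}
    (hr : ∀ f ∈ 𝓕, ∀ x, IsRanking (f x) (rank f x))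
    (hρ : ∀ f ∈ 𝓕, ∀ π, MeasurableSet {x | rank f x = π})
    {fstar : X → Fin A → ℝ} (hstar : fstar ∈ 𝓕) {γ : ℕ → ℝ} (hγ : Monotone γ) (hγ1 : γ 1 = 0)
    {l : ℕ} (hl : 1 ≤ l) (e : ℕ → X → Fin A → ℝ) (he : ∀ j, 1 ≤ j → j ≤ l → e j ∈ 𝓕)
    (herr : ∀ i, 2 ≤ i → i ≤ l → 0 < γ i ∧ ∃ j, 1 ≤ j ∧ j < i ∧
      policyError μ (explorePolicy k hk hkA (γ j) (e j) (rank (e j))) (e i) fstar ≤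
        k * ((A : ℝ) - k + 1) / γ i ^ 2) :
    γ l * policyRegret μ k fstar (explorePolicy k hk hkA (γ l) (e l) (rank (e l))) ≤
      11 * (k * ((A : ℝ) - k + 1)) := by
  have hm : 1 ≤ (A : ℝ) - k + 1 := by
    have : (k : ℝ) ≤ A := by exact_mod_cast hkA
    linarith
  have hk' : (1 : ℝ) ≤ k := by exact_mod_cast hk
  have hpos : ∀ j, 1 ≤ j → 0 ≤ γ j := fun j hj => hγ1 ▸ hγ hj
  have key : ∀ i, 1 ≤ i → i ≤ l → ∀ q, IsPolicy k q →
      γ i * policyRegret μ k fstar q ≤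
          2 * γ i * policyRegret μ k (e i) q + 9 * (k * ((A : ℝ) - k + 1)) ∧
        γ i * policyRegret μ k (e i) q ≤
          2 * γ i * policyRegret μ k fstar q + 9 * (k * ((A : ℝ) - k + 1)) := by
    intro i
    induction i using Nat.strong_induction_on with
    | _ i ih =>
      intro hi1 hil q hq
      rcases hi1.eq_or_lt with rfl | hi2
      -- In the first epoch the factor is zero and both inequalities reduce to `0 ≤ 9 * K`.
      · rw [hγ1]
        constructor <;> nlinarith
      · obtain ⟨hs, j, hj1, hji, hj⟩ := herr i hi2 hil
        exact policyRegret_comparison μ hk hkA h𝓕 hr hρ hstar (he j hj1 (by omega))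
          (he i hi1 hil) (hpos j hj1) (hγ hji.le) hs hj
          (fun q hq => (ih j hji hj1 (by omega) q hq).2) hq
  have hl' := he l hl le_rfl
  have h1 := (key l hl le_rfl _ (isPolicy_explorePolicy hk hkA (hpos l hl) (h𝓕 _ hl') (hρ _ hl')
    (hr _ hl'))).1
  have h2 := mul_policyRegret_explorePolicy_le hk hkA μ (hpos l hl) (h𝓕 _ hl') (hρ _ hl')
    (hr _ hl')
  -- `2 * m + 9 * k * m ≤ 11 * k * m`, as `k ≥ 1`.
  nlinarith

end Policies

/-! ### Conditional expectations, independence and finitely valued variables -/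

section ConditionalExpectation

variable {Ω : Type*} {m₁ m₂ mΩ : MeasurableSpace Ω} {P : Measure Ω}

lemma sup_eq_generateFrom_inter (m₁ m₂ : MeasurableSpace Ω) :
    m₁ ⊔ m₂ = MeasurableSpace.generateFrom
      {s | ∃ u v, MeasurableSet[m₁] u ∧ MeasurableSet[m₂] v ∧ s = u ∩ v} := by
  apply le_antisymm
  · refine sup_le (fun u hu => ?_) (fun v hv => ?_)
    · exact MeasurableSpace.measurableSet_generateFrom
        ⟨u, Set.univ, hu, MeasurableSet.univ, (Set.inter_univ u).symm⟩
    · exact MeasurableSpace.measurableSet_generateFrom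
        ⟨Set.univ, v, MeasurableSet.univ, hv, (Set.univ_inter v).symm⟩
  · refine MeasurableSpace.generateFrom_le ?_
    rintro _ ⟨u, v, hu, hv, rfl⟩
    exact MeasurableSet.inter (le_sup_left (a := m₁) (b := m₂) u hu)
      (le_sup_right (a := m₁) (b := m₂) v hv)

/-- The intersections `u ∩ v` form a π-system generating the join, and Dynkin's argument applies.
The case `u = v = univ` gives total integral zero, as needed for complements. -/
lemma setIntegral_eq_zero_of_sup (hm₁ : m₁ ≤ mΩ) (hm₂ : m₂ ≤ mΩ) {w : Ω → ℝ}
    (hw : Integrable w P)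
    (h : ∀ u v, MeasurableSet[m₁] u → MeasurableSet[m₂] v → ∫ ω in u ∩ v, w ω ∂P = 0)
    {s : Set Ω} (hs : MeasurableSet[m₁ ⊔ m₂] s) : ∫ ω in s, w ω ∂P = 0 := by
  have hle : m₁ ⊔ m₂ ≤ mΩ := sup_le hm₁ hm₂
  have huniv : ∫ ω, w ω ∂P = 0 := by
    simpa using h Set.univ Set.univ MeasurableSet.univ MeasurableSet.univ
  refine MeasurableSpace.induction_on_inter (C := fun s _ => ∫ ω in s, w ω ∂P = 0)
    (sup_eq_generateFrom_inter m₁ m₂) ?_ (by simp) ?_ ?_ ?_ s hs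
  · rintro _ ⟨u, v, hu, hv, rfl⟩ _ ⟨u', v', hu', hv', rfl⟩ _
    exact ⟨u ∩ u', v ∩ v', hu.inter hu', hv.inter hv', Set.inter_inter_inter_comm u v u' v'⟩
  · rintro _ ⟨u, v, hu, hv, rfl⟩
    exact h u v hu hv
  · intro t ht h0
    have := integral_add_compl (hle t ht) hw
    rw [huniv, h0] at this
    linarith
  · intro f hd hf h0
    rw [integral_iUnion (fun i => hle _ (hf i)) hd hw.integrableOn]
    simp [h0]

variable [IsFiniteMeasure P]

lemma integral_mul_condExp (hm : m₁ ≤ mΩ) {U g : Ω → ℝ} (hU : Measurable[m₁] U) {C : ℝ}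
    (hC : ∀ᵐ ω ∂P, |U ω| ≤ C) (hg : Integrable g P) :
    ∫ ω, U ω * (P[g | m₁]) ω ∂P = ∫ ω, U ω * g ω ∂P := by
  have h1 : Integrable (U * g) P :=
    hg.bdd_mul (hU.mono hm le_rfl).aestronglyMeasurable hC
  have h2 := condExp_mul_of_stronglyMeasurable_left hU.stronglyMeasurable h1 hg
  have h3 := integral_condExp hm (μ := P) (f := U * g)
  rw [integral_congr_ae h2] at h3
  exact h3

/-- If the conditional laws of `R` given two σ-algebras agree, so do the conditional expectations
of functions of `R`. -/
lemma condExp_comp_ae_eq {E : Type*} [MeasurableSpace E] {R : Ω → E} (hR : Measurable R)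
    (h : ∀ B, MeasurableSet B → P⟦R ⁻¹' B | m₁⟧ =ᵐ[P] P⟦R ⁻¹' B | m₂⟧) {g : E → ℝ}
    (hg : Integrable g (P.map R)) : P[g ∘ R | m₁] =ᵐ[P] P[g ∘ R | m₂] := by
  have hint : ∀ s : SimpleFunc E ℝ, Integrable (s ∘ R) P := fun s =>
    (s.integrable_of_isFiniteMeasure (μ := P.map R)).comp_measurable hR
  have simple : ∀ s : SimpleFunc E ℝ, P[s ∘ R | m₁] =ᵐ[P] P[s ∘ R | m₂] := by
    intro s
    induction s using SimpleFunc.induction with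
    | @const c B hB =>
      have h1 : (SimpleFunc.piecewise B hB (SimpleFunc.const E c) (SimpleFunc.const E 0)) ∘ R =
          c • (R ⁻¹' B).indicator fun _ => (1 : ℝ) := by
        classical
        funext ω
        by_cases hω : R ω ∈ B <;> simp [hω]
      rw [h1]
      filter_upwards [condExp_smul (μ := P) c ((R ⁻¹' B).indicator fun _ => (1 : ℝ)) m₁,
        condExp_smul (μ := P) c ((R ⁻¹' B).indicator fun _ => (1 : ℝ)) m₂, h B hB]
        with ω h2 h3 h4
      rw [h2, h3, Pi.smul_apply, Pi.smul_apply, h4]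
    | @add f g _ ihf ihg =>
      have h1 : (⇑(f + g)) ∘ R = f ∘ R + g ∘ R := rfl
      rw [h1]
      filter_upwards [condExp_add (hint f) (hint g) m₁, condExp_add (hint f) (hint g) m₂, ihf, ihg]
        with ω h2 h3 h4 h5
      rw [h2, h3, Pi.add_apply, Pi.add_apply, h4, h5]
  have hgR : Integrable (g ∘ R) P := hg.comp_measurable hR
  have hzero : eLpNorm (P[g ∘ R | m₁] - P[g ∘ R | m₂]) 1 P = 0 := by
    by_contra hne
    -- Replacing `g` by `g - s` does not change the difference of the two conditional expectations.
    -- As each is an `L¹` contraction, an approximation closer than half the norm of the difference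
    -- makes that norm smaller than itself.
    obtain ⟨s, hs, hs'⟩ := (memLp_one_iff_integrable.2 hg).exists_simpleFunc_eLpNorm_sub_lt
      ENNReal.one_ne_top (ENNReal.half_pos hne).ne'
    rw [eLpNorm_map_measure (hg.aestronglyMeasurable.sub hs'.1) hR.aemeasurable] at hs
    have h1 : P[g ∘ R | m₁] - P[g ∘ R | m₂] =ᵐ[P]
        P[(g - ⇑s) ∘ R | m₁] - P[(g - ⇑s) ∘ R | m₂] := by
      have h0 : (g - ⇑s) ∘ R = g ∘ R - s ∘ R := rfl
      rw [h0]
      filter_upwards [condExp_sub hgR (hint s) m₁, condExp_sub hgR (hint s) m₂, simple s]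
        with ω h2 h3 h4
      simp only [Pi.sub_apply] at h2 h3 ⊢
      rw [h2, h3, h4]
      ring
    have h2 := eLpNorm_condExp_le_eLpNorm (μ := P) (m := m₁) ((g - ⇑s) ∘ R) (p := 1) le_rfl
    have h3 := eLpNorm_condExp_le_eLpNorm (μ := P) (m := m₂) ((g - ⇑s) ∘ R) (p := 1) le_rfl
    have h4 := eLpNorm_sub_le (μ := P) (p := 1)
      (integrable_condExp (μ := P) (m := m₁) (f := (g - ⇑s) ∘ R)).aestronglyMeasurable
      (integrable_condExp (μ := P) (m := m₂) (f := (g - ⇑s) ∘ R)).aestronglyMeasurable le_rfl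
    rw [eLpNorm_congr_ae h1] at hs hne
    refine (h4.trans (add_le_add h2 h3)).not_gt ?_
    calc _ < _ := ENNReal.add_lt_add hs hs
      _ = _ := ENNReal.add_halves _
  rw [eLpNorm_eq_zero_iff (integrable_condExp.aestronglyMeasurable.sub
    integrable_condExp.aestronglyMeasurable) one_ne_zero] at hzero
  filter_upwards [hzero] with ω hω
  simpa [sub_eq_zero] using hω

end ConditionalExpectation

section Independence

variable {Ω X E : Type*} {m₁ mΩ : MeasurableSpace Ω} [MeasurableSpace X] [MeasurableSpace E]
  {P : Measure Ω} [IsProbabilityMeasure P]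

lemma integral_mul_comp_of_indep (hm₁ : m₁ ≤ mΩ) {Z : Ω → E} (hZ : Measurable Z)
    (hind : Indep (MeasurableSpace.comap Z inferInstance) m₁ P) {U : Ω → ℝ}
    (hU : Measurable[m₁] U) {C : ℝ} (hC : ∀ᵐ ω ∂P, |U ω| ≤ C) {φ : E → ℝ} (hφ : Measurable φ)
    (hi : Integrable (φ ∘ Z) P) :
    ∫ ω, U ω * φ (Z ω) ∂P = (∫ ω, U ω ∂P) * ∫ z, φ z ∂(P.map Z) := by
  have h1 := condExp_indep_eq hZ.comap_le hm₁
    (hφ.comp (comap_measurable Z)).stronglyMeasurable hind (μ := P)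
  have h2 := integral_mul_condExp hm₁ hU hC hi
  rw [integral_map hZ.aemeasurable hφ.aestronglyMeasurable, ← integral_mul_const]
  refine h2.symm.trans (integral_congr_ae ?_)
  filter_upwards [h1] with ω hω
  rw [hω]
  rfl

/-- The conditional expectation of a function of a pair `(X, R)` given `X` and some information
that is independent of the pair. -/
lemma condExp_sup_comap_ae_eq (hm₁ : m₁ ≤ mΩ) {Z : Ω → X × E} (hZ : Measurable Z)
    (hind : Indep (MeasurableSpace.comap Z inferInstance) m₁ P) {φ : X × E → ℝ}
    (hφ : Measurable φ) (hi : Integrable φ (P.map Z)) {h : X → ℝ} (hh : Measurable h)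
    (hφh : (P.map Z)[φ | MeasurableSpace.comap Prod.fst inferInstance] =ᵐ[P.map Z]
      fun z => h z.1) :
    P[φ ∘ Z | m₁ ⊔ MeasurableSpace.comap (fun ω => (Z ω).1) inferInstance] =ᵐ[P]
      fun ω => h (Z ω).1 := by
  have : IsProbabilityMeasure (P.map Z) := Measure.isProbabilityMeasure_map hZ.aemeasurable
  have hm₂ : MeasurableSpace.comap (fun ω => (Z ω).1) inferInstance ≤ mΩ :=
    (measurable_fst.comp hZ).comap_le
  have hle := sup_le hm₁ hm₂
  have hi' : Integrable (φ ∘ Z) P := hi.comp_measurable hZ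
  have hh' : Integrable (fun z : X × E => h z.1) (P.map Z) := integrable_condExp.congr hφh
  have hhZ : Integrable (fun ω => h (Z ω).1) P := hh'.comp_measurable hZ
  symm
  refine ae_eq_condExp_of_forall_setIntegral_eq hle hi' (fun s _ _ => hhZ.integrableOn) ?_ ?_
  · intro s hs _
    have h0 := setIntegral_eq_zero_of_sup hm₁ hm₂ (w := fun ω => h (Z ω).1 - φ (Z ω))
      (hhZ.sub hi') ?_ hs
    · rw [integral_sub (f := fun ω => h (Z ω).1) (g := fun ω => φ (Z ω)) hhZ.integrableOn
        hi'.integrableOn] at h0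
      exact sub_eq_zero.1 h0
    · rintro u _ hu ⟨B, hB, rfl⟩
      have hu' := hm₁ u hu
      have hB' : MeasurableSet (Prod.fst ⁻¹' B : Set (X × E)) := measurable_fst hB
      -- On an intersection the integrand is an indicator of the past times a function of the pair.
      -- Independence splits the integral, and the second factor vanishes by `hφh`.
      have h1 : ∀ ω, (u ∩ (fun ω => (Z ω).1) ⁻¹' B).indicator
          (fun ω => h (Z ω).1 - φ (Z ω)) ω = u.indicator (fun _ => (1 : ℝ)) ω *
            (Prod.fst ⁻¹' B).indicator (fun z : X × E => h z.1 - φ z) (Z ω) := by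
        intro ω
        by_cases h1 : ω ∈ u <;> by_cases h2 : (Z ω).1 ∈ B <;> simp [h1, h2]
      have hv : MeasurableSet ((fun ω => (Z ω).1) ⁻¹' B) := (measurable_fst.comp hZ) hB
      rw [← integral_indicator (hu'.inter hv)]
      simp only [h1]
      rw [integral_mul_comp_of_indep hm₁ hZ hind
        ((measurable_const.indicator hu : Measurable[m₁] (u.indicator fun _ => (1 : ℝ))))
        (C := 1) (Filter.Eventually.of_forall fun ω => ?_)
        (φ := (Prod.fst ⁻¹' B).indicator fun z : X × E => h z.1 - φ z)
        (((hh.comp measurable_fst).sub hφ).indicator hB')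
        (((hh'.sub hi).indicator hB').comp_measurable hZ)]
      · rw [integral_indicator hB', integral_sub hh'.integrableOn hi.integrableOn]
        have h2 := setIntegral_condExp (μ := P.map Z) measurable_fst.comap_le hi ⟨B, hB, rfl⟩
        rw [setIntegral_congr_ae hB' (hφh.mono fun z hz _ => hz)] at h2
        rw [h2, sub_self, mul_zero]
      · by_cases h1 : ω ∈ u <;> simp [h1]
  · refine Measurable.aestronglyMeasurable ?_
    exact (hh.comp (comap_measurable fun ω => (Z ω).1)).mono le_sup_right le_rfl

end Independence

section FiniteValued

variable {Ω : Type*} {m : MeasurableSpace Ω}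

lemma comap_top_le_of_finite {ι : Type*} [Finite ι] {V : Ω → ι}
    (h : ∀ i, MeasurableSet[m] {ω | V ω = i}) : MeasurableSpace.comap V ⊤ ≤ m := by
  rintro _ ⟨B, -, rfl⟩
  have : V ⁻¹' B = ⋃ i ∈ B, {ω | V ω = i} := by ext; simp
  rw [this]
  exact MeasurableSet.biUnion (Set.to_countable B) fun i _ => h i

lemma apply_eq_sum_ite {ι : Type*} [DecidableEq ι] {s : Finset ι} {i : ι} (hi : i ∈ s)
    (φ : ι → ℝ) : φ i = ∑ j ∈ s, if i = j then φ j else 0 := by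
  simp [hi]

/-- Used for estimates: they take values in a function space without a σ-algebra, but only finitely
many, on measurable events. -/
lemma measurable_apply_of_mem {ι : Type*} {s : Finset ι} {V : Ω → ι} (hV : ∀ ω, V ω ∈ s)
    (h : ∀ i ∈ s, MeasurableSet[m] {ω | V ω = i}) {φ : ι → Ω → ℝ}
    (hφ : ∀ i ∈ s, Measurable[m] (φ i)) : Measurable[m] fun ω => φ (V ω) ω := by
  classical
  simp only [fun ω => apply_eq_sum_ite (hV ω) fun i => φ i ω]
  exact Finset.measurable_sum _ fun i hi => Measurable.ite (h i hi) (hφ i hi) measurable_const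

end FiniteValued

/-! ### Consequences of the feedback model -/

namespace IsEnvironment

variable {X Ω : Type*} {A : ℕ} [MeasurableSpace X] [mΩ : MeasurableSpace Ω] {P : Measure Ω}
  {𝓗 : Filtration ℕ mΩ} {I : Interaction X Ω A} {D : Measure (X × (Fin A → ℝ))} {c : ℝ} {T : ℕ}

lemma infoContext_le (henv : IsEnvironment P 𝓗 I D c T) {t : ℕ} (ht : t ∈ Finset.Icc 1 T) :
    infoContext I 𝓗 t ≤ 𝓗 t :=
  sup_le (𝓗.mono (Nat.sub_le t 1)) (henv.measurable_context t ht).comap_le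

lemma infoChosen_le (henv : IsEnvironment P 𝓗 I D c T) {t : ℕ} (ht : t ∈ Finset.Icc 1 T) :
    infoChosen I 𝓗 t ≤ 𝓗 t :=
  sup_le (henv.infoContext_le ht) (comap_top_le_of_finite (henv.measurable_chosen t ht))

lemma infoRevealed_le (henv : IsEnvironment P 𝓗 I D c T) {t : ℕ} (ht : t ∈ Finset.Icc 1 T) :
    infoRevealed I 𝓗 t ≤ 𝓗 t :=
  sup_le (henv.infoChosen_le ht) (comap_top_le_of_finite (henv.measurable_revealed t ht))

lemma measurable_context' (henv : IsEnvironment P 𝓗 I D c T) {t : ℕ} (ht : t ∈ Finset.Icc 1 T) :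
    Measurable (I.context t) :=
  (henv.measurable_context t ht).mono (𝓗.le t) le_rfl

lemma measurable_pair (henv : IsEnvironment P 𝓗 I D c T) {t : ℕ} (ht : t ∈ Finset.Icc 1 T) :
    Measurable fun ω => (I.context t ω, I.reward t ω) :=
  (henv.measurable_context' ht).prodMk (henv.measurable_reward t ht)

lemma map_context (henv : IsEnvironment P 𝓗 I D c T) {t : ℕ} (ht : t ∈ Finset.Icc 1 T) :
    P.map (I.context t) = D.map Prod.fst := by
  rw [← henv.law t ht, Measure.map_map measurable_fst (henv.measurable_pair ht)]
  rfl

lemma reward_mem_Icc (henv : IsEnvironment P 𝓗 I D c T) {t : ℕ} (ht : t ∈ Finset.Icc 1 T) :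
    ∀ᵐ ω ∂P, ∀ a, I.reward t ω a ∈ Set.Icc (0 : ℝ) 1 := by
  have h := henv.reward_mem
  rw [← henv.law t ht] at h
  exact ae_of_ae_map (henv.measurable_pair ht).aemeasurable h

lemma measurable_reward_apply (henv : IsEnvironment P 𝓗 I D c T) {t : ℕ}
    (ht : t ∈ Finset.Icc 1 T) (a : Fin A) : Measurable fun ω => I.reward t ω a :=
  (measurable_pi_apply a).comp (henv.measurable_reward t ht)

lemma measurable_comp_chosen (henv : IsEnvironment P 𝓗 I D c T) {t : ℕ}
    (ht : t ∈ Finset.Icc 1 T) {h : X → Finset (Fin A) → ℝ}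
    (hh : ∀ S, Measurable fun x => h x S) :
    Measurable[𝓗 t] fun ω => h (I.context t ω) (I.chosen t ω) :=
  measurable_apply_of_mem (s := Finset.univ) (fun _ => Finset.mem_univ _)
    (fun S _ => henv.measurable_chosen t ht S) (φ := fun S ω => h (I.context t ω) S)
    fun S _ => (hh S).comp (henv.measurable_context t ht)

variable [IsProbabilityMeasure P]

lemma integrable_reward (henv : IsEnvironment P 𝓗 I D c T) {t : ℕ} (ht : t ∈ Finset.Icc 1 T)
    (a : Fin A) : Integrable (fun ω => I.reward t ω a) P := by
  refine Integrable.of_bound (henv.measurable_reward_apply ht a).aestronglyMeasurable 1 ?_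
  filter_upwards [henv.reward_mem_Icc ht] with ω hω
  rw [Real.norm_of_nonneg (hω a).1]
  exact (hω a).2

/-- Conditional independence removes the chosen and revealed sets from the conditioning,
independence of the rounds removes the past, and realizability evaluates what is left. -/
lemma condExp_reward (henv : IsEnvironment P 𝓗 I D c T) {t : ℕ} (ht : t ∈ Finset.Icc 1 T)
    {fstar : X → Fin A → ℝ} (hf : IsUnitValued fstar) (hreal : IsRegressionFunction D fstar)
    (a : Fin A) : P[fun ω => I.reward t ω a | infoRevealed I 𝓗 t] =ᵐ[P]
      fun ω => fstar (I.context t ω) a := by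
  have hr := henv.measurable_reward t ht
  have hi := henv.integrable_reward ht a
  have h1 : P[(fun r : Fin A → ℝ => r a) ∘ I.reward t | infoRevealed I 𝓗 t] =ᵐ[P]
      P[(fun r : Fin A → ℝ => r a) ∘ I.reward t | infoContext I 𝓗 t] :=
    condExp_comp_ae_eq hr (henv.condIndep t ht) ((integrable_map_measure
      (measurable_pi_apply a).aestronglyMeasurable hr.aemeasurable).2 hi)
  have hφ : Measurable fun z : X × (Fin A → ℝ) => z.2 a :=
    (measurable_pi_apply a).comp measurable_snd
  have h2 := condExp_sup_comap_ae_eq (𝓗.le (t - 1)) (henv.measurable_pair ht) (henv.indep t ht)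
    hφ ((integrable_map_measure hφ.aestronglyMeasurable
      (henv.measurable_pair ht).aemeasurable).2 hi) (hf a).1 (by
        rw [henv.law t ht]
        exact hreal a)
  exact h1.trans h2

/-- The noise of the rewards is centered given the past, the context and the selections. -/
lemma integral_mul_noise (henv : IsEnvironment P 𝓗 I D c T) {t : ℕ} (ht : t ∈ Finset.Icc 1 T)
    {fstar : X → Fin A → ℝ} (hf : IsUnitValued fstar) (hreal : IsRegressionFunction D fstar)
    (a : Fin A) {U : Ω → ℝ} (hU : Measurable[infoRevealed I 𝓗 t] U) {C : ℝ}
    (hC : ∀ᵐ ω ∂P, |U ω| ≤ C) :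
    ∫ ω, U ω * (fstar (I.context t ω) a - I.reward t ω a) ∂P = 0 := by
  have hle := (henv.infoRevealed_le ht).trans (𝓗.le t)
  have h1 := integral_mul_condExp hle hU hC (henv.integrable_reward ht a)
  have hU' : AEStronglyMeasurable U P := (hU.mono hle le_rfl).aestronglyMeasurable
  have hce := henv.condExp_reward ht hf hreal a
  have hfi : Integrable (fun ω => fstar (I.context t ω) a) P := integrable_condExp.congr hce
  simp only [mul_sub]
  rw [integral_sub (hfi.bdd_mul hU' hC) ((henv.integrable_reward ht a).bdd_mul hU' hC), ← h1,
    sub_eq_zero]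
  refine integral_congr_ae ?_
  filter_upwards [hce] with ω hω
  rw [hω]

/-- The feedback condition bounds the revealing probability on the event that `a` is chosen; off
this event the left integrand vanishes and the right one, after conditioning, is nonnegative. -/
lemma le_integral_mul_revealed (henv : IsEnvironment P 𝓗 I D c T) {t : ℕ}
    (ht : t ∈ Finset.Icc 1 T) (a : Fin A) {U : Ω → ℝ}
    (hU : Measurable[infoChosen I 𝓗 t] U) (hU0 : 0 ≤ U) {C : ℝ} (hC : ∀ᵐ ω ∂P, |U ω| ≤ C) :
    c * ∫ ω, U ω * (if a ∈ I.chosen t ω then 1 else 0) ∂P ≤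
      ∫ ω, U ω * (if a ∈ I.revealed t ω then 1 else 0) ∂P := by
  have hle := (henv.infoChosen_le ht).trans (𝓗.le t)
  have hset : ∀ {m : MeasurableSpace Ω} {V : Ω → Finset (Fin A)},
      (∀ S, MeasurableSet[m] {ω | V ω = S}) → MeasurableSet[m] {ω | a ∈ V ω} := fun hV =>
    comap_top_le_of_finite hV _ ⟨{S | a ∈ S}, trivial, rfl⟩
  have hrev : MeasurableSet {ω | a ∈ I.revealed t ω} :=
    𝓗.le t _ (hset (henv.measurable_revealed t ht))
  have hcho : MeasurableSet {ω | a ∈ I.chosen t ω} :=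
    𝓗.le t _ (hset (henv.measurable_chosen t ht))
  have hi : Integrable ({ω | a ∈ I.revealed t ω}.indicator fun _ => (1 : ℝ)) P :=
    (integrable_const 1).indicator hrev
  have hi' : Integrable ({ω | a ∈ I.chosen t ω}.indicator fun _ => (1 : ℝ)) P :=
    (integrable_const 1).indicator hcho
  have h1 := integral_mul_condExp hle hU hC hi
  have hU' : AEStronglyMeasurable U P := (hU.mono hle le_rfl).aestronglyMeasurable
  have e1 : ∀ ω, (if a ∈ I.revealed t ω then (1 : ℝ) else 0) =
      {ω | a ∈ I.revealed t ω}.indicator (fun _ => (1 : ℝ)) ω := fun ω => by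
    simp [Set.indicator_apply]
  have e2 : ∀ ω, (if a ∈ I.chosen t ω then (1 : ℝ) else 0) =
      {ω | a ∈ I.chosen t ω}.indicator (fun _ => (1 : ℝ)) ω := fun ω => by
    simp [Set.indicator_apply]
  simp only [e1, e2]
  rw [← h1, ← integral_const_mul]
  refine integral_mono_ae ((hi'.bdd_mul hU' hC).const_mul c)
    (integrable_condExp.bdd_mul hU' hC) ?_
  have h0 : 0 ≤ᵐ[P] P⟦{ω | a ∈ I.revealed t ω} | infoChosen I 𝓗 t⟧ :=
    condExp_nonneg (Filter.Eventually.of_forall fun ω =>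
      Set.indicator_nonneg (fun _ _ => zero_le_one) ω)
  filter_upwards [henv.feedback t ht a, h0] with ω h2 h3
  by_cases hω : a ∈ I.chosen t ω
  · have := mul_le_mul_of_nonneg_left (h2 hω) (hU0 ω)
    simp only [Set.indicator_apply, Set.mem_ofPred_eq, hω, if_true]
    linarith
  · simp only [Set.indicator_apply, Set.mem_ofPred_eq, hω, if_false, mul_zero]
    exact mul_nonneg (hU0 ω) h3

lemma integral_mul_context (henv : IsEnvironment P 𝓗 I D c T) {t : ℕ}
    (ht : t ∈ Finset.Icc 1 T) {U : Ω → ℝ} (hU : Measurable[𝓗 (t - 1)] U) {C : ℝ}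
    (hC : ∀ᵐ ω ∂P, |U ω| ≤ C) {φ : X → ℝ} (hφ : Measurable φ)
    (hi : Integrable (fun ω => φ (I.context t ω)) P) :
    ∫ ω, U ω * φ (I.context t ω) ∂P = (∫ ω, U ω ∂P) * ∫ x, φ x ∂(D.map Prod.fst) := by
  rw [← henv.map_context ht]
  refine integral_mul_comp_of_indep (𝓗.le (t - 1)) (henv.measurable_context' ht) ?_ hU hC hφ hi
  refine indep_of_indep_of_le_left (henv.indep t ht) ?_
  rintro _ ⟨B, hB, rfl⟩
  exact ⟨Prod.fst ⁻¹' B, measurable_fst hB, rfl⟩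

end IsEnvironment

/-! ### The law of the chosen set -/

section Selection

variable {A k : ℕ} (hk : 1 ≤ k) (hkA : k ≤ A) {γ : ℝ} {y : Fin A → ℝ} {π : Equiv.Perm (Fin A)}

lemma selectionProb_nonneg (hγ : 0 ≤ γ) (hπ : IsRanking y π) (S : Finset (Fin A)) :
    0 ≤ selectionProb k hk hkA γ y π S := by
  have hy : ∀ a ∈ (greedyArms k π)ᶜ, y a ≤ y (pivotArm k hk hkA π) :=
    fun a ha => le_pivotArm hk hkA hπ ha
  refine Finset.sum_nonneg fun a ha => ?_
  split_ifs
  · exact (igw_pos hγ (pivotArm_mem hk hkA) hy ha).le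
  · exact le_rfl

lemma selectionProb_le_one (hγ : 0 ≤ γ) (hπ : IsRanking y π) (S : Finset (Fin A)) :
    selectionProb k hk hkA γ y π S ≤ 1 := by
  rw [← sum_selectionProb hk hkA (γ := γ) (y := y) (π := π)]
  exact Finset.single_le_sum (fun S _ => selectionProb_nonneg hk hkA hγ hπ S) (Finset.mem_univ S)

lemma measurable_selectionProb {X : Type*} [MeasurableSpace X] {f : X → Fin A → ℝ}
    {ρ : X → Equiv.Perm (Fin A)} (hf : IsUnitValued f) (hρ : ∀ π, MeasurableSet {x | ρ x = π})
    (S : Finset (Fin A)) : Measurable fun x => selectionProb k hk hkA γ (f x) (ρ x) S := by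
  refine measurable_comp_rank hρ (φ := fun π x => selectionProb k hk hkA γ (f x) π S) fun π => ?_
  unfold selectionProb
  refine Finset.measurable_sum _ fun a _ => ?_
  split_ifs
  · exact measurable_igw hf _ _ _ _
  · exact measurable_const

end Selection

section Run

variable {X Ω : Type*} {A : ℕ} [MeasurableSpace X] [mΩ : MeasurableSpace Ω] {P : Measure Ω}
  [IsProbabilityMeasure P] {𝓗 : Filtration ℕ mΩ} {I : Interaction X Ω A}
  {D : Measure (X × (Fin A → ℝ))} {c : ℝ} {T : ℕ} {𝓕 : Finset (X → Fin A → ℝ)}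
  {rank : (X → Fin A → ℝ) → X → Equiv.Perm (Fin A)} {k : ℕ} {hk : 1 ≤ k} {hkA : k ≤ A}
  {γ : ℕ → ℝ}

/-- The expectation, given the past, of a function of the context and of the chosen arms. -/
lemma integral_mul_chosen (henv : IsEnvironment P 𝓗 I D c T)
    (halg : IsAlgorithmRun P 𝓗 I 𝓕 rank k hk hkA γ T) (h𝓕 : ∀ f ∈ 𝓕, IsUnitValued f)
    (hγ : ∀ l, 0 ≤ γ l) {l t : ℕ} (hl : 1 ≤ l) (h1 : epochEnd (l - 1) < t) (h2 : t ≤ epochEnd l)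
    (htT : t ≤ T) {U : Ω → ℝ} (hU : Measurable[𝓗 (t - 1)] U) {C : ℝ}
    (hC : ∀ᵐ ω ∂P, |U ω| ≤ C) {h : X → Finset (Fin A) → ℝ} (hh : ∀ S, Measurable fun x => h x S)
    {B : ℝ} (hB : ∀ x S, |h x S| ≤ B) :
    ∫ ω, U ω * h (I.context t ω) (I.chosen t ω) ∂P =
      ∫ ω, U ω * ∫ x, ∑ S, selectionProb k hk hkA (γ l) (I.estimate l ω x)
        (rank (I.estimate l ω) x) S * h x S ∂(D.map Prod.fst) ∂P := by
  classical
  have ht : t ∈ Finset.Icc 1 T := Finset.mem_Icc.2 ⟨by omega, htT⟩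
  have hlT : epochEnd (l - 1) < T := h1.trans_le htT
  have hest : ∀ f ∈ 𝓕, MeasurableSet[𝓗 (t - 1)] {ω | I.estimate l ω = f} := fun f hf =>
    𝓗.mono (by omega) _ (halg.measurable_estimate l hl hlT f hf)
  have hmem := halg.estimate_mem l hl hlT
  have : IsProbabilityMeasure (D.map Prod.fst) := by
    rw [← henv.map_context ht]
    exact Measure.isProbabilityMeasure_map (henv.measurable_context' ht).aemeasurable
  let q : (X → Fin A → ℝ) → X → Finset (Fin A) → ℝ := fun f x S =>
    selectionProb k hk hkA (γ l) (f x) (rank f x) S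
  have hq : ∀ f ∈ 𝓕, ∀ S, Measurable fun x => q f x S := fun f hf S =>
    measurable_selectionProb hk hkA (h𝓕 f hf) (halg.measurable_rank f hf) S
  have hq1 : ∀ f ∈ 𝓕, ∀ x S, |q f x S| ≤ 1 := fun f hf x S => by
    rw [abs_of_nonneg (selectionProb_nonneg hk hkA (hγ l) (halg.isRanking f hf x) S)]
    exact selectionProb_le_one hk hkA (hγ l) (halg.isRanking f hf x) S
  have hqh : ∀ f ∈ 𝓕, ∀ S, Measurable fun x => q f x S * h x S := fun f hf S =>
    (hq f hf S).mul (hh S)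
  have hqhB : ∀ f ∈ 𝓕, ∀ x S, ‖q f x S * h x S‖ ≤ B := fun f hf x S => by
    rw [Real.norm_eq_abs, abs_mul]
    have := mul_le_mul (hq1 f hf x S) (hB x S) (abs_nonneg _) zero_le_one
    simpa using this
  -- the part of `U` on the event that the estimate is `f`
  let V : (X → Fin A → ℝ) → Ω → ℝ := fun f ω => if I.estimate l ω = f then U ω else 0
  have hV : ∀ f ∈ 𝓕, Measurable[𝓗 (t - 1)] (V f) := fun f hf =>
    Measurable.ite (hest f hf) hU measurable_const
  have hVC : ∀ f, ∀ᵐ ω ∂P, |V f ω| ≤ C := fun f => by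
    filter_upwards [hC] with ω hω
    simp only [V]
    split_ifs
    · exact hω
    · rw [abs_zero]; exact (abs_nonneg _).trans hω
  have hVm : ∀ f ∈ 𝓕, AEStronglyMeasurable (V f) P := fun f hf =>
    ((hV f hf).mono (𝓗.le _) le_rfl).aestronglyMeasurable
  have hind : ∀ S, Integrable ({ω | I.chosen t ω = S}.indicator fun _ => (1 : ℝ)) P := fun S =>
    (integrable_const 1).indicator (𝓗.le t _ (henv.measurable_chosen t ht S))
  have hVh : ∀ f ∈ 𝓕, ∀ S, Measurable[infoContext I 𝓗 t]
      fun ω => V f ω * h (I.context t ω) S := fun f hf S =>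
    ((hV f hf).mono le_sup_left le_rfl).mul
      (((hh S).comp (comap_measurable (I.context t))).mono le_sup_right le_rfl)
  have hVhB : ∀ f, ∀ S, ∀ᵐ ω ∂P, |V f ω * h (I.context t ω) S| ≤ C * B := fun f S => by
    filter_upwards [hVC f] with ω hω
    rw [abs_mul]
    exact mul_le_mul hω (hB _ S) (abs_nonneg _) ((abs_nonneg _).trans hω)
  have hle : infoContext I 𝓗 t ≤ mΩ := (henv.infoContext_le ht).trans (𝓗.le t)
  -- Once estimate and chosen set are frozen, the selection law turns the indicator of the set into
  -- a fixed function of the context, which is independent of the past factor `V f`.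
  have step : ∀ f ∈ 𝓕, ∀ S, ∫ ω, (V f ω * h (I.context t ω) S) *
      {ω | I.chosen t ω = S}.indicator (fun _ => (1 : ℝ)) ω ∂P =
      (∫ ω, V f ω ∂P) * ∫ x, q f x S * h x S ∂(D.map Prod.fst) := by
    intro f hf S
    rw [← integral_mul_condExp hle (hVh f hf S) (hVhB f S) (hind S),
      ← henv.integral_mul_context ht (hV f hf) (hVC f) (hqh f hf S)
        (Integrable.of_bound ((hqh f hf S).comp
          (henv.measurable_context' ht)).aestronglyMeasurable B
          (Filter.Eventually.of_forall fun ω => hqhB f hf _ S))]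
    refine integral_congr_ae ?_
    filter_upwards [halg.selection l hl t h1 h2 htT S] with ω hω
    rw [hω]
    simp only [V, q]
    split_ifs with he
    · rw [he]; ring
    · simp
  have lhs : ∀ ω, U ω * h (I.context t ω) (I.chosen t ω) = ∑ f ∈ 𝓕, ∑ S,
      (V f ω * h (I.context t ω) S) *
        {ω | I.chosen t ω = S}.indicator (fun _ => (1 : ℝ)) ω := by
    intro ω
    simp [V, Set.indicator_apply, hmem ω]
  have rhs : ∀ ω, U ω * ∫ x, ∑ S, selectionProb k hk hkA (γ l) (I.estimate l ω x)
      (rank (I.estimate l ω) x) S * h x S ∂(D.map Prod.fst) =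
      ∑ f ∈ 𝓕, V f ω * ∫ x, ∑ S, q f x S * h x S ∂(D.map Prod.fst) := by
    intro ω
    simp [V, q, hmem ω]
  simp only [lhs, rhs]
  rw [integral_finsetSum, integral_finsetSum]
  · refine Finset.sum_congr rfl fun f hf => ?_
    rw [integral_finsetSum, integral_mul_const, integral_finsetSum, Finset.mul_sum]
    · exact Finset.sum_congr rfl fun S _ => step f hf S
    · exact fun S _ => Integrable.of_bound (hqh f hf S).aestronglyMeasurable B
        (Filter.Eventually.of_forall fun x => hqhB f hf x S)
    · exact fun S _ => (hind S).bdd_mul ((hVh f hf S).mono hle le_rfl).aestronglyMeasurable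
        (hVhB f S)
  · exact fun f hf => ((Integrable.of_bound (hVm f hf) C (hVC f))).mul_const _
  · exact fun f hf => integrable_finsetSum _ fun S _ =>
      (hind S).bdd_mul ((hVh f hf S).mono hle le_rfl).aestronglyMeasurable (hVhB f S)

/-- The algorithm chooses exactly `k` arms. -/
lemma ae_card_chosen (henv : IsEnvironment P 𝓗 I D c T)
    (halg : IsAlgorithmRun P 𝓗 I 𝓕 rank k hk hkA γ T) (h𝓕 : ∀ f ∈ 𝓕, IsUnitValued f)
    (hγ : ∀ l, 0 ≤ γ l) {l t : ℕ} (hl : 1 ≤ l) (h1 : epochEnd (l - 1) < t) (h2 : t ≤ epochEnd l)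
    (htT : t ≤ T) : ∀ᵐ ω ∂P, (I.chosen t ω).card = k := by
  have ht : t ∈ Finset.Icc 1 T := Finset.mem_Icc.2 ⟨by omega, htT⟩
  -- The indicator of a wrong cardinality has mean zero under the selection law, hence vanishes
  -- almost surely.
  let h : X → Finset (Fin A) → ℝ := fun _ S => if S.card = k then 0 else 1
  have hh : ∀ S, Measurable fun x => h x S := fun S => measurable_const
  have hB : ∀ x S, |h x S| ≤ 1 := fun x S => by
    simp only [h]
    split_ifs <;> simp
  have h3 := integral_mul_chosen henv halg h𝓕 hγ hl h1 h2 htT (U := fun _ => 1)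
    measurable_const (C := 1) (Filter.Eventually.of_forall fun ω => by simp) hh hB
  have h4 : ∀ ω x, ∑ S, selectionProb k hk hkA (γ l) (I.estimate l ω x)
      (rank (I.estimate l ω) x) S * h x S = 0 := by
    intro ω x
    rw [sum_selectionProb_mul]
    refine Finset.sum_eq_zero fun a ha => ?_
    simp [h, card_insert_greedyArms hk hkA ha]
  simp only [h4, integral_zero, mul_zero, one_mul] at h3
  have hm := (henv.measurable_comp_chosen ht hh).mono (𝓗.le t) le_rfl
  rw [integral_eq_zero_iff_of_nonneg (fun ω => by simp only [h]; positivity)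
    (Integrable.of_bound hm.aestronglyMeasurable 1 (Filter.Eventually.of_forall fun ω =>
      hB (I.context t ω) (I.chosen t ω)))] at h3
  filter_upwards [h3] with ω hω
  by_contra hne
  simp [h, hne] at hω

end Run

/-! ### Epochs -/

section Epochs

lemma epochEnd_mono : Monotone epochEnd := by
  intro i j hij
  unfold epochEnd
  split_ifs with hi hj
  · exact le_rfl
  · exact Nat.zero_le _
  · omega
  · exact Nat.pow_le_pow_right two_pos hij

/-- The epoch of the round `t`. -/
def epochIndex (t : ℕ) : ℕ := max 1 (Nat.clog 2 t)

lemma one_le_epochIndex (t : ℕ) : 1 ≤ epochIndex t := le_max_left _ _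

lemma le_epochEnd_epochIndex (t : ℕ) : t ≤ epochEnd (epochIndex t) := by
  have h := one_le_epochIndex t
  rw [epochEnd, if_neg (by omega)]
  exact (Nat.le_pow_clog one_lt_two t).trans (Nat.pow_le_pow_right two_pos (le_max_right _ _))

lemma epochEnd_epochIndex_sub_one_lt {t : ℕ} (ht : 1 ≤ t) : epochEnd (epochIndex t - 1) < t := by
  -- Rounds 1 and 2 have logarithms 0 and 1 but share epoch 1, whose left end is 0 and not `2 ^ 0`.
  rcases le_or_gt (Nat.clog 2 t) 1 with h | h
  · have : epochIndex t = 1 := max_eq_left h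
    rw [this]
    simp only [epochEnd, Nat.sub_self, if_true]
    omega
  · have h1 : epochIndex t = Nat.clog 2 t := max_eq_right h.le
    rw [h1, epochEnd, if_neg (by omega)]
    have h2 : 1 < t := by
      by_contra hle
      have : Nat.clog 2 t = 0 := Nat.clog_of_right_le_one (by omega) 2
      omega
    exact Nat.pow_pred_clog_lt_self one_lt_two h2

lemma epochIndex_lt {t l : ℕ} (ht : 1 ≤ t) (h : t ≤ epochEnd (l - 1)) : epochIndex t < l := by
  by_contra hle
  have := epochEnd_mono (show l - 1 ≤ epochIndex t - 1 by omega)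
  have := epochEnd_epochIndex_sub_one_lt ht
  omega

end Epochs

/-! ### Exponential bound for the excess squared loss -/

section ExcessLoss

variable {ι : Type*} {S : Finset ι} {k : ℕ} {f g r : ι → ℝ}

lemma abs_sum_excess_le (hS : S.card ≤ k) (hf : ∀ a, f a ∈ Set.Icc (0 : ℝ) 1)
    (hg : ∀ a, g a ∈ Set.Icc (0 : ℝ) 1) (hr : ∀ a, r a ∈ Set.Icc (0 : ℝ) 1) :
    |∑ a ∈ S, ((f a - r a) ^ 2 - (g a - r a) ^ 2)| ≤ k := by
  have h1 : ∀ a ∈ S, |(f a - r a) ^ 2 - (g a - r a) ^ 2| ≤ 1 := by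
    intro a _
    obtain ⟨h1, h2⟩ := hf a
    obtain ⟨h3, h4⟩ := hg a
    obtain ⟨h5, h6⟩ := hr a
    rw [abs_le]
    constructor <;> nlinarith [sq_nonneg (f a - r a), sq_nonneg (g a - r a)]
  refine (Finset.abs_sum_le_sum_abs _ _).trans ((Finset.sum_le_card_nsmul _ _ 1 h1).trans ?_)
  rw [nsmul_eq_mul, mul_one]
  exact_mod_cast hS

/-- A bound for the exponential of the excess loss, which is linear in the squared deviation
and in the noise. -/
lemma exp_neg_excess_le (hk : 1 ≤ k) (hS : S.card ≤ k) (hf : ∀ a, f a ∈ Set.Icc (0 : ℝ) 1)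
    (hg : ∀ a, g a ∈ Set.Icc (0 : ℝ) 1) (hr : ∀ a, r a ∈ Set.Icc (0 : ℝ) 1) :
    Real.exp (-(∑ a ∈ S, ((f a - r a) ^ 2 - (g a - r a) ^ 2)) / (8 * k)) ≤
      1 - (∑ a ∈ S, (f a - g a) ^ 2) / (16 * k) -
        (∑ a ∈ S, (f a - g a) * (g a - r a)) / (4 * k) := by
  have hk' : (1 : ℝ) ≤ k := by exact_mod_cast hk
  have hY := abs_sum_excess_le hS hf hg hr
  have hdecomp : ∑ a ∈ S, ((f a - r a) ^ 2 - (g a - r a) ^ 2) =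
      ∑ a ∈ S, (f a - g a) ^ 2 + 2 * ∑ a ∈ S, (f a - g a) * (g a - r a) := by
    rw [Finset.mul_sum, ← Finset.sum_add_distrib]
    exact Finset.sum_congr rfl fun a _ => by ring
  -- Cauchy-Schwarz over at most `k` arms: the square of the excess loss is bounded by its noiseless
  -- part.
  have hsq : (∑ a ∈ S, ((f a - r a) ^ 2 - (g a - r a) ^ 2)) ^ 2 ≤
      k * (4 * ∑ a ∈ S, (f a - g a) ^ 2) := by
    refine (sq_sum_le_card_mul_sum_sq).trans ?_
    refine mul_le_mul (by exact_mod_cast hS) ?_ (Finset.sum_nonneg fun a _ => sq_nonneg _)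
      (by linarith)
    rw [Finset.mul_sum]
    refine Finset.sum_le_sum fun a _ => ?_
    obtain ⟨h1, h2⟩ := hf a
    obtain ⟨h3, h4⟩ := hg a
    obtain ⟨h5, h6⟩ := hr a
    have h7 : (f a + g a - 2 * r a) ^ 2 ≤ 4 := by
      rw [show (4 : ℝ) = 2 ^ 2 by norm_num]
      exact sq_le_sq' (by linarith) (by linarith)
    have := mul_le_mul_of_nonneg_right h7 (sq_nonneg (f a - g a))
    calc _ = (f a + g a - 2 * r a) ^ 2 * (f a - g a) ^ 2 := by ring
      _ ≤ _ := this
  set Y := ∑ a ∈ S, ((f a - r a) ^ 2 - (g a - r a) ^ 2)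
  set Z := ∑ a ∈ S, (f a - g a) ^ 2
  set W := ∑ a ∈ S, (f a - g a) * (g a - r a)
  have hx : |-Y / (8 * k)| ≤ 1 := by
    rw [abs_div, abs_neg, abs_of_nonneg (by positivity : (0 : ℝ) ≤ 8 * k),
      div_le_one (by positivity)]
    linarith
  -- `exp x ≤ 1 + x + x ^ 2` for `|x| ≤ 1`. With the scale `8 * k` the square costs half of the
  -- negative drift `Z / (8 * k)`.
  have h1 := (abs_le.1 (Real.abs_exp_sub_one_sub_id_le hx)).2
  have h2 : (-Y / (8 * k)) ^ 2 ≤ Z / (16 * k) := by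
    rw [div_pow, neg_sq, div_le_div_iff₀ (by positivity) (by positivity)]
    have := mul_le_mul_of_nonneg_right hsq (show (0 : ℝ) ≤ 16 * k by positivity)
    nlinarith
  have h3 : -Y / (8 * k) = - (2 * (Z / (16 * k))) - W / (4 * k) := by
    rw [hdecomp]
    field_simp
    ring
  linarith

end ExcessLoss

/-! ### The exponential supermartingale -/

section Concentration

/-- The excess of the squared error of `f` over the one of `g` in round `t`. -/
def Interaction.excessLoss {X Ω : Type*} {A : ℕ} (I : Interaction X Ω A) (f g : X → Fin A → ℝ)
    (t : ℕ) (ω : Ω) : ℝ :=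
  ∑ a ∈ I.revealed t ω, ((f (I.context t ω) a - I.reward t ω a) ^ 2 -
    (g (I.context t ω) a - I.reward t ω a) ^ 2)

lemma Interaction.sum_excessLoss {X Ω : Type*} {A : ℕ} (I : Interaction X Ω A)
    (f g : X → Fin A → ℝ) (n : ℕ) (ω : Ω) :
    ∑ t ∈ Finset.Icc 1 n, I.excessLoss f g t ω = I.squaredLoss n f ω - I.squaredLoss n g ω := by
  simp only [Interaction.excessLoss, Interaction.squaredLoss, Finset.sum_sub_distrib]

variable {X Ω : Type*} {A : ℕ} [MeasurableSpace X] [mΩ : MeasurableSpace Ω] {P : Measure Ω}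
  {𝓗 : Filtration ℕ mΩ} {I : Interaction X Ω A}
  {D : Measure (X × (Fin A → ℝ))} {c : ℝ} {T : ℕ} {𝓕 : Finset (X → Fin A → ℝ)}
  {rank : (X → Fin A → ℝ) → X → Equiv.Perm (Fin A)} {k : ℕ} {hk : 1 ≤ k} {hkA : k ≤ A}
  {γ : ℕ → ℝ}

lemma policyError_mem (μ : Measure X) [IsProbabilityMeasure μ] {q f g : X → Fin A → ℝ}
    (hq : IsPolicy k q) (hf : IsUnitValued f) (hg : IsUnitValued g) :
    policyError μ q f g ∈ Set.Icc (0 : ℝ) k := by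
  refine ⟨integral_nonneg fun x => Finset.sum_nonneg fun a _ =>
    mul_nonneg ((hq.fractional x).1 a).1 (sq_nonneg _), ?_⟩
  have hd : ∀ x a, (f x a - g x a) ^ 2 ≤ 1 := fun x a =>
    (sq_le_one_iff_abs_le_one _).2 (abs_sub_le_one_of_isUnitValued hf hg x a)
  have h := integral_mono (hq.integrable_sum μ (d := fun x a => (f x a - g x a) ^ 2)
    (fun a => ((hf a).1.sub (hg a).1).pow_const 2)
    (fun x a => by rw [abs_of_nonneg (sq_nonneg _)]; exact hd x a)) (integrable_const (k : ℝ))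
    fun x => by
      rw [← (hq.fractional x).2]
      exact Finset.sum_le_sum fun a _ =>
        mul_le_of_le_one_right ((hq.fractional x).1 a).1 (hd x a)
  simpa [policyError] using h

/-- The policy of the algorithm in epoch `l`. -/
noncomputable abbrev epochPolicy (I : Interaction X Ω A)
    (rank : (X → Fin A → ℝ) → X → Equiv.Perm (Fin A)) (k : ℕ) (hk : 1 ≤ k) (hkA : k ≤ A)
    (γ : ℕ → ℝ) (l : ℕ) (ω : Ω) : X → Fin A → ℝ :=
  explorePolicy k hk hkA (γ l) (I.estimate l ω) (rank (I.estimate l ω))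

lemma isPolicy_epochPolicy (halg : IsAlgorithmRun P 𝓗 I 𝓕 rank k hk hkA γ T)
    (h𝓕 : ∀ f ∈ 𝓕, IsUnitValued f) (hγ : ∀ l, 0 ≤ γ l) {l : ℕ} (hl : 1 ≤ l)
    (hlT : epochEnd (l - 1) < T) (ω : Ω) : IsPolicy k (epochPolicy I rank k hk hkA γ l ω) := by
  have h := halg.estimate_mem l hl hlT ω
  exact isPolicy_explorePolicy hk hkA (hγ l) (h𝓕 _ h) (halg.measurable_rank _ h)
    (halg.isRanking _ h)

/-- The policy of an epoch takes finitely many values and is fixed before the epoch starts, so `Ψ`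
may be arbitrary. -/
lemma measurable_comp_epochPolicy (halg : IsAlgorithmRun P 𝓗 I 𝓕 rank k hk hkA γ T)
    {l t : ℕ} (hl : 1 ≤ l) (hlt : epochEnd (l - 1) < t) (htT : t ≤ T)
    (Ψ : (X → Fin A → ℝ) → ℝ) :
    Measurable[𝓗 (t - 1)] fun ω => Ψ (epochPolicy I rank k hk hkA γ l ω) :=
  measurable_apply_of_mem (halg.estimate_mem l hl (hlt.trans_le htT))
    (fun f hf => 𝓗.mono (by omega) _ (halg.measurable_estimate l hl (hlt.trans_le htT) f hf))
    (φ := fun f _ => Ψ (explorePolicy k hk hkA (γ l) f (rank f))) fun _ _ => measurable_const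

lemma IsEnvironment.measurable_excessLoss (henv : IsEnvironment P 𝓗 I D c T) {t : ℕ}
    (ht : t ∈ Finset.Icc 1 T) {f g : X → Fin A → ℝ} (hf : IsUnitValued f) (hg : IsUnitValued g) :
    Measurable[𝓗 t] (I.excessLoss f g t) := by
  classical
  -- The history need not contain the unrevealed rewards, so the loss is written through the
  -- observed feedback.
  have h : I.excessLoss f g t = fun ω => ∑ a, if a ∈ I.revealed t ω then
      (f (I.context t ω) a - if a ∈ I.revealed t ω then I.reward t ω a else 0) ^ 2 -
      (g (I.context t ω) a - if a ∈ I.revealed t ω then I.reward t ω a else 0) ^ 2 else 0 := by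
    funext ω
    rw [← Finset.sum_filter, Finset.filter_mem_eq_inter, Finset.univ_inter]
    exact Finset.sum_congr rfl fun a ha => by simp [ha]
  rw [h]
  have hx := henv.measurable_context t ht
  refine Finset.measurable_sum _ fun a _ => Measurable.ite ?_ ?_ measurable_const
  · exact comap_top_le_of_finite (henv.measurable_revealed t ht) _ ⟨{S | a ∈ S}, trivial, rfl⟩
  · have hw := henv.measurable_feedback t ht a
    exact ((((hf a).1.comp hx).sub hw).pow_const 2).sub ((((hg a).1.comp hx).sub hw).pow_const 2)

variable [IsProbabilityMeasure P]

lemma IsEnvironment.isProbabilityMeasure_map_fst (henv : IsEnvironment P 𝓗 I D c T) {t : ℕ}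
    (ht : t ∈ Finset.Icc 1 T) : IsProbabilityMeasure (D.map Prod.fst) := by
  rw [← henv.map_context ht]
  exact Measure.isProbabilityMeasure_map (henv.measurable_context' ht).aemeasurable

lemma ae_round (henv : IsEnvironment P 𝓗 I D c T)
    (halg : IsAlgorithmRun P 𝓗 I 𝓕 rank k hk hkA γ T) (h𝓕 : ∀ f ∈ 𝓕, IsUnitValued f)
    (hγ : ∀ l, 0 ≤ γ l) {l t : ℕ} (hl : 1 ≤ l) (h1 : epochEnd (l - 1) < t) (h2 : t ≤ epochEnd l)
    (htT : t ≤ T) : ∀ᵐ ω ∂P, (I.revealed t ω).card ≤ k ∧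
      ∀ a, I.reward t ω a ∈ Set.Icc (0 : ℝ) 1 := by
  have ht : t ∈ Finset.Icc 1 T := Finset.mem_Icc.2 ⟨by omega, htT⟩
  filter_upwards [ae_card_chosen henv halg h𝓕 hγ hl h1 h2 htT, henv.reward_mem_Icc ht]
    with ω h3 h4
  exact ⟨h3 ▸ Finset.card_le_card (henv.revealed_subset t ht ω), h4⟩

/-- The exponential moment of the excess loss in one round, given the past. -/
lemma integral_mul_exp_excessLoss_le (henv : IsEnvironment P 𝓗 I D c T)
    (halg : IsAlgorithmRun P 𝓗 I 𝓕 rank k hk hkA γ T) (h𝓕 : ∀ f ∈ 𝓕, IsUnitValued f)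
    (hγ : ∀ l, 0 ≤ γ l) {l t : ℕ} (hl : 1 ≤ l) (h1 : epochEnd (l - 1) < t) (h2 : t ≤ epochEnd l)
    (htT : t ≤ T) (hc : 0 ≤ c) {f fstar : X → Fin A → ℝ} (hf : f ∈ 𝓕) (hstar : fstar ∈ 𝓕)
    (hreal : IsRegressionFunction D fstar) {U : Ω → ℝ} (hU : Measurable[𝓗 (t - 1)] U)
    (hU0 : 0 ≤ U) {C : ℝ} (hC : ∀ᵐ ω ∂P, |U ω| ≤ C) :
    ∫ ω, U ω * Real.exp (-(I.excessLoss f fstar t ω) / (8 * k)) ∂P ≤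
      ∫ ω, U ω * Real.exp (-(c * policyError (D.map Prod.fst)
        (epochPolicy I rank k hk hkA γ l ω) f fstar) / (16 * k)) ∂P := by
  classical
  have ht : t ∈ Finset.Icc 1 T := Finset.mem_Icc.2 ⟨by omega, htT⟩
  have := henv.isProbabilityMeasure_map_fst ht
  have hf' := h𝓕 f hf
  have hs' := h𝓕 fstar hstar
  have hk' : (1 : ℝ) ≤ k := by exact_mod_cast hk
  let d : Fin A → Ω → ℝ := fun a ω => f (I.context t ω) a - fstar (I.context t ω) a
  have hd1 : ∀ a ω, |d a ω| ≤ 1 := fun a ω => abs_sub_le_one_of_isUnitValued hf' hs' _ a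
  have hdm : ∀ a, Measurable[infoContext I 𝓗 t] (d a) := fun a =>
    (((hf' a).1.sub (hs' a).1).comp (comap_measurable (I.context t))).mono le_sup_right le_rfl
  have hUm : Measurable[infoContext I 𝓗 t] U := hU.mono le_sup_left le_rfl
  have hUP : AEStronglyMeasurable U P := (hU.mono (𝓗.le _) le_rfl).aestronglyMeasurable
  have hUi : Integrable U P := Integrable.of_bound hUP C hC
  let rev : Fin A → Ω → ℝ := fun a ω => if a ∈ I.revealed t ω then 1 else 0
  have hrevset : ∀ {m : MeasurableSpace Ω}, (∀ S, MeasurableSet[m] {ω | I.revealed t ω = S}) →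
      ∀ a, Measurable[m] (rev a) := fun hm a =>
    Measurable.ite (comap_top_le_of_finite hm _ ⟨{S | a ∈ S}, trivial, rfl⟩) measurable_const
      measurable_const
  have hrev : ∀ a, Measurable[infoRevealed I 𝓗 t] (rev a) := hrevset fun S =>
    le_sup_right (a := infoChosen I 𝓗 t) _ ⟨{S}, trivial, rfl⟩
  have hrevP : ∀ a, Measurable (rev a) := fun a =>
    (hrev a).mono ((henv.infoRevealed_le ht).trans (𝓗.le t)) le_rfl
  have hrev1 : ∀ a ω, |rev a ω| ≤ 1 := fun a ω => by
    simp only [rev]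
    split_ifs <;> simp
  let Z : Ω → ℝ := fun ω => ∑ a ∈ I.revealed t ω, d a ω ^ 2
  let W : Ω → ℝ := fun ω => ∑ a ∈ I.revealed t ω, d a ω *
    (fstar (I.context t ω) a - I.reward t ω a)
  have hsum : ∀ ω (φ : Fin A → ℝ), ∑ a ∈ I.revealed t ω, φ a = ∑ a, rev a ω * φ a := by
    intro ω φ
    simp [rev]
  have hUZ : ∀ ω, U ω * Z ω = ∑ a, (U ω * d a ω ^ 2) * rev a ω := fun ω => by
    simp only [Z]
    rw [hsum, Finset.mul_sum]
    exact Finset.sum_congr rfl fun a _ => by ring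
  have hUW : ∀ ω, U ω * W ω = ∑ a, (U ω * d a ω * rev a ω) *
      (fstar (I.context t ω) a - I.reward t ω a) := fun ω => by
    simp only [W]
    rw [hsum, Finset.mul_sum]
    exact Finset.sum_congr rfl fun a _ => by ring
  have bZ : ∀ a, ∀ᵐ ω ∂P, |U ω * d a ω ^ 2| ≤ C := fun a => by
    filter_upwards [hC] with ω hω
    rw [abs_mul, abs_of_nonneg (sq_nonneg (d a ω))]
    exact (mul_le_of_le_one_right (abs_nonneg _)
      ((sq_le_one_iff_abs_le_one _).2 (hd1 a ω))).trans hω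
  have bW : ∀ a, ∀ᵐ ω ∂P, |U ω * d a ω * rev a ω| ≤ C := fun a => by
    filter_upwards [hC] with ω hω
    rw [abs_mul, abs_mul]
    exact (mul_le_of_le_one_right (by positivity) (hrev1 a ω)).trans
      ((mul_le_of_le_one_right (abs_nonneg _) (hd1 a ω)).trans hω)
  have mZ : ∀ a, Measurable[infoContext I 𝓗 t] fun ω => U ω * d a ω ^ 2 := fun a =>
    hUm.mul ((hdm a).pow_const 2)
  have mW : ∀ a, Measurable[infoRevealed I 𝓗 t] fun ω => U ω * d a ω * rev a ω := fun a =>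
    ((hUm.mul (hdm a)).mono (le_sup_left.trans le_sup_left) le_rfl).mul (hrev a)
  have ctxP : infoContext I 𝓗 t ≤ mΩ := (henv.infoContext_le ht).trans (𝓗.le t)
  have iZ : ∀ a, Integrable (fun ω => (U ω * d a ω ^ 2) * rev a ω) P := fun a =>
    (Integrable.of_bound (hrevP a).aestronglyMeasurable 1
      (Filter.Eventually.of_forall (hrev1 a))).bdd_mul
      ((mZ a).mono ctxP le_rfl).aestronglyMeasurable (bZ a)
  have inoise : ∀ a, Integrable
      (fun ω => fstar (I.context t ω) a - I.reward t ω a) P := fun a =>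
    (Integrable.of_bound ((hs' a).1.comp (henv.measurable_context' ht)).aestronglyMeasurable 1
      (Filter.Eventually.of_forall fun ω => by
        have := (hs' a).2 (I.context t ω)
        rw [Function.comp_apply, Real.norm_of_nonneg this.1]
        exact this.2)).sub (henv.integrable_reward ht a)
  have iW : ∀ a, Integrable (fun ω => (U ω * d a ω * rev a ω) *
      (fstar (I.context t ω) a - I.reward t ω a)) P := fun a =>
    (inoise a).bdd_mul ((mW a).mono ((henv.infoRevealed_le ht).trans (𝓗.le t))
      le_rfl).aestronglyMeasurable (bW a)
  have hUWint : Integrable (fun ω => U ω * W ω) P := by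
    simp only [hUW]
    exact integrable_finsetSum _ fun a _ => iW a
  have hUZint : Integrable (fun ω => U ω * Z ω) P := by
    simp only [hUZ]
    exact integrable_finsetSum _ fun a _ => iZ a
  -- Linearity in the noise pays off here: each arm's noise is centered, and no independence between
  -- arms is needed.
  have hW0 : ∫ ω, U ω * W ω ∂P = 0 := by
    simp only [hUW]
    rw [integral_finsetSum _ fun a _ => iW a]
    exact Finset.sum_eq_zero fun a _ => henv.integral_mul_noise ht hs' hreal a (mW a) (bW a)
  have hchosen : ∫ ω, U ω * policyError (D.map Prod.fst)
      (epochPolicy I rank k hk hkA γ l ω) f fstar ∂P =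
      ∫ ω, U ω * ∑ a ∈ I.chosen t ω, d a ω ^ 2 ∂P := by
    have h3 := integral_mul_chosen henv halg h𝓕 hγ hl h1 h2 htT hU hC
      (h := fun x S => ∑ a ∈ S, (f x a - fstar x a) ^ 2)
      (fun S => Finset.measurable_sum _ fun a _ => ((hf' a).1.sub (hs' a).1).pow_const 2)
      (B := A) fun x S => by
        rw [abs_of_nonneg (Finset.sum_nonneg fun a _ => sq_nonneg _)]
        refine (Finset.sum_le_card_nsmul _ _ 1 fun a _ => (sq_le_one_iff_abs_le_one _).2
          (abs_sub_le_one_of_isUnitValued hf' hs' x a)).trans ?_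
        have := Finset.card_le_univ S
        rw [Fintype.card_fin] at this
        rw [nsmul_eq_mul, mul_one]
        exact_mod_cast this
    simp only [sum_selectionProb_mul_sum] at h3
    exact h3.symm
  have hZ : c * ∫ ω, U ω * policyError (D.map Prod.fst)
      (epochPolicy I rank k hk hkA γ l ω) f fstar ∂P ≤ ∫ ω, U ω * Z ω ∂P := by
    rw [hchosen]
    have h3 : ∀ ω, U ω * ∑ a ∈ I.chosen t ω, d a ω ^ 2 =
        ∑ a, (U ω * d a ω ^ 2) * (if a ∈ I.chosen t ω then 1 else 0) := fun ω => by
      rw [Finset.mul_sum]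
      simp
    have hcho : ∀ a, Measurable fun ω => if a ∈ I.chosen t ω then (1 : ℝ) else 0 := fun a =>
      Measurable.ite (𝓗.le t _ (comap_top_le_of_finite (henv.measurable_chosen t ht) _
        ⟨{S | a ∈ S}, trivial, rfl⟩)) measurable_const measurable_const
    have i3 : ∀ a, Integrable (fun ω => (U ω * d a ω ^ 2) *
        (if a ∈ I.chosen t ω then (1 : ℝ) else 0)) P := fun a =>
      (Integrable.of_bound (hcho a).aestronglyMeasurable 1
        (Filter.Eventually.of_forall fun ω => by split_ifs <;> simp)).bdd_mul
        ((mZ a).mono ctxP le_rfl).aestronglyMeasurable (bZ a)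
    simp only [h3, hUZ]
    rw [integral_finsetSum _ fun a _ => i3 a, integral_finsetSum _ fun a _ => iZ a,
      Finset.mul_sum]
    exact Finset.sum_le_sum fun a _ => henv.le_integral_mul_revealed ht a
      ((mZ a).mono le_sup_left le_rfl) (fun ω => mul_nonneg (hU0 ω) (sq_nonneg _)) (bZ a)
  have hψm : Measurable fun ω => policyError (D.map Prod.fst)
      (epochPolicy I rank k hk hkA γ l ω) f fstar :=
    (measurable_comp_epochPolicy halg hl h1 htT fun q =>
      policyError (D.map Prod.fst) q f fstar).mono (𝓗.le _) le_rfl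
  have hψ : ∀ ω, policyError (D.map Prod.fst) (epochPolicy I rank k hk hkA γ l ω) f fstar ∈
      Set.Icc (0 : ℝ) k := fun ω => policyError_mem _ (isPolicy_epochPolicy halg h𝓕 hγ hl
    (h1.trans_le htT) ω) hf' hs'
  set ψ : Ω → ℝ := fun ω => policyError (D.map Prod.fst) (epochPolicy I rank k hk hkA γ l ω)
    f fstar
  have hψi : Integrable (fun ω => U ω * ψ ω) P :=
    (Integrable.of_bound hψm.aestronglyMeasurable (k : ℝ) (Filter.Eventually.of_forall fun ω => by
      rw [Real.norm_of_nonneg (hψ ω).1]; exact (hψ ω).2)).bdd_mul hUP hC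
  have hae := ae_round henv halg h𝓕 hγ hl h1 h2 htT
  have hYm : Measurable (I.excessLoss f fstar t) :=
    (henv.measurable_excessLoss ht hf' hs').mono (𝓗.le t) le_rfl
  have hlhs : Integrable (fun ω => U ω * Real.exp (-(I.excessLoss f fstar t ω) / (8 * k))) P := by
    refine (Integrable.of_bound (hYm.neg.div_const (8 * (k : ℝ))).exp.aestronglyMeasurable
      (Real.exp 1) ?_).bdd_mul hUP hC
    filter_upwards [hae] with ω hω
    rw [Real.norm_eq_abs, Real.abs_exp, Real.exp_le_exp, div_le_one (by positivity)]
    have := abs_sum_excess_le hω.1 (fun a => (hf' a).2 (I.context t ω))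
      (fun a => (hs' a).2 (I.context t ω)) hω.2
    have := (abs_le.1 this).1
    simp only [Interaction.excessLoss, Pi.neg_apply]
    linarith
  have hrhs : Integrable (fun ω => U ω * Real.exp (-(c * ψ ω) / (16 * k))) P := by
    refine (Integrable.of_bound
      ((hψm.const_mul c).neg.div_const (16 * (k : ℝ))).exp.aestronglyMeasurable
      1 (Filter.Eventually.of_forall fun ω => ?_)).bdd_mul hUP hC
    rw [Real.norm_eq_abs, Real.abs_exp, Real.exp_le_one_iff]
    refine div_nonpos_of_nonpos_of_nonneg ?_ (by positivity)
    simp only [Pi.neg_apply, Left.neg_nonpos_iff]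
    exact mul_nonneg hc (hψ ω).1
  have hmid : ∀ᵐ ω ∂P, U ω * Real.exp (-(I.excessLoss f fstar t ω) / (8 * k)) ≤
      U ω - 1 / (16 * k) * (U ω * Z ω) - 1 / (4 * k) * (U ω * W ω) := by
    filter_upwards [hae] with ω hω
    have h3 := exp_neg_excess_le hk hω.1 (fun a => (hf' a).2 (I.context t ω))
      (fun a => (hs' a).2 (I.context t ω)) hω.2
    have h4 := mul_le_mul_of_nonneg_left h3 (hU0 ω)
    refine h4.trans_eq ?_
    simp only [Z, W, d]
    ring
  have hlow : ∀ ω, U ω - c / (16 * k) * (U ω * ψ ω) ≤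
      U ω * Real.exp (-(c * ψ ω) / (16 * k)) := fun ω => by
    have h3 := Real.add_one_le_exp (-(c * ψ ω) / (16 * k))
    have h4 := mul_le_mul_of_nonneg_left h3 (hU0 ω)
    refine le_of_eq_of_le ?_ h4
    ring
  -- The noise integrates to zero, `Z` is replaced by `c * ψ` on average, and `1 + x ≤ exp x`
  -- restores an exponential.
  calc _ ≤ ∫ ω, (U ω - 1 / (16 * k) * (U ω * Z ω) - 1 / (4 * k) * (U ω * W ω)) ∂P :=
        integral_mono_ae hlhs ((hUi.sub (hUZint.const_mul _)).sub (hUWint.const_mul _)) hmid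
    _ = ∫ ω, U ω ∂P - 1 / (16 * k) * ∫ ω, U ω * Z ω ∂P := by
        have hi : Integrable (fun ω => U ω - 1 / (16 * k) * (U ω * Z ω)) P :=
          hUi.sub (hUZint.const_mul _)
        rw [integral_sub hi (hUWint.const_mul _),
          integral_sub hUi (hUZint.const_mul _), integral_const_mul, integral_const_mul, hW0]
        ring
    _ ≤ ∫ ω, U ω ∂P - c / (16 * k) * ∫ ω, U ω * ψ ω ∂P := by
        have := mul_le_mul_of_nonneg_left hZ (show (0 : ℝ) ≤ 1 / (16 * k) by positivity)
        refine sub_le_sub_left (le_of_eq_of_le ?_ this) _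
        ring
    _ = ∫ ω, (U ω - c / (16 * k) * (U ω * ψ ω)) ∂P := by
        rw [integral_sub hUi (hψi.const_mul _), integral_const_mul]
    _ ≤ _ := integral_mono (hUi.sub (hψi.const_mul _)) hrhs hlow

/-- The exponential process that controls the errors of `f` under the policies of the past. -/
noncomputable def errorExp (μ : Measure X) (I : Interaction X Ω A)
    (rank : (X → Fin A → ℝ) → X → Equiv.Perm (Fin A)) (k : ℕ) (hk : 1 ≤ k) (hkA : k ≤ A)
    (γ : ℕ → ℝ) (c : ℝ) (f g : X → Fin A → ℝ) (n : ℕ) (ω : Ω) : ℝ :=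
  Real.exp (∑ t ∈ Finset.Icc 1 n, (c * policyError μ
    (epochPolicy I rank k hk hkA γ (epochIndex t) ω) f g / (16 * k) -
      I.excessLoss f g t ω / (8 * k)))

/-- Induction on `n`: the new factor `exp (c * ψ / (16 * k))` belongs to the past and cancels
against the one-round bound. Measurability and boundedness are carried along because that bound
demands them of its weight. -/
lemma integral_errorExp_le (henv : IsEnvironment P 𝓗 I D c T)
    (halg : IsAlgorithmRun P 𝓗 I 𝓕 rank k hk hkA γ T) (h𝓕 : ∀ f ∈ 𝓕, IsUnitValued f)
    (hγ : ∀ l, 0 ≤ γ l) (hc : 0 ≤ c) {f fstar : X → Fin A → ℝ} (hf : f ∈ 𝓕)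
    (hstar : fstar ∈ 𝓕) (hreal : IsRegressionFunction D fstar) (n : ℕ) (hn : n ≤ T) :
    Measurable[𝓗 n] (errorExp (D.map Prod.fst) I rank k hk hkA γ c f fstar n) ∧
      (∃ C, ∀ᵐ ω ∂P, |errorExp (D.map Prod.fst) I rank k hk hkA γ c f fstar n ω| ≤ C) ∧
      ∫ ω, errorExp (D.map Prod.fst) I rank k hk hkA γ c f fstar n ω ∂P ≤ 1 := by
  have hf' := h𝓕 f hf
  have hs' := h𝓕 fstar hstar
  have hk' : (1 : ℝ) ≤ k := by exact_mod_cast hk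
  induction n with
  | zero =>
    have h0 : errorExp (D.map Prod.fst) I rank k hk hkA γ c f fstar 0 = fun _ => 1 :=
      funext fun ω => by simp [errorExp]
    rw [h0]
    exact ⟨measurable_const, ⟨1, by simp⟩, by simp⟩
  | succ n ih =>
    obtain ⟨hm, ⟨C, hC⟩, hint⟩ := ih (by omega)
    have ht : n + 1 ∈ Finset.Icc 1 T := Finset.mem_Icc.2 ⟨by omega, hn⟩
    have := henv.isProbabilityMeasure_map_fst ht
    have hl := one_le_epochIndex (n + 1)
    have h1 := epochEnd_epochIndex_sub_one_lt (show 1 ≤ n + 1 by omega)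
    have h2 := le_epochEnd_epochIndex (n + 1)
    set M := errorExp (D.map Prod.fst) I rank k hk hkA γ c f fstar n
    set ψ : Ω → ℝ := fun ω => policyError (D.map Prod.fst)
      (epochPolicy I rank k hk hkA γ (epochIndex (n + 1)) ω) f fstar
    have hsucc : errorExp (D.map Prod.fst) I rank k hk hkA γ c f fstar (n + 1) = fun ω =>
        M ω * Real.exp (c * ψ ω / (16 * k)) *
          Real.exp (-(I.excessLoss f fstar (n + 1) ω) / (8 * k)) :=
      funext fun ω => by
        simp only [M, errorExp]
        rw [Finset.sum_Icc_succ_top (by omega), mul_assoc, ← Real.exp_add, ← Real.exp_add]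
        congr 1
        ring
    have hψm : Measurable[𝓗 n] ψ := measurable_comp_epochPolicy halg hl h1 hn fun q =>
      policyError (D.map Prod.fst) q f fstar
    have hψ : ∀ ω, ψ ω ∈ Set.Icc (0 : ℝ) k := fun ω => policyError_mem _
      (isPolicy_epochPolicy halg h𝓕 hγ hl (h1.trans_le hn) ω) hf' hs'
    have hUm : Measurable[𝓗 n] fun ω => M ω * Real.exp (c * ψ ω / (16 * k)) :=
      hm.mul ((hψm.const_mul c).div_const _).exp
    have hUC : ∀ᵐ ω ∂P, |M ω * Real.exp (c * ψ ω / (16 * k))| ≤ C * Real.exp c := by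
      filter_upwards [hC] with ω hω
      rw [abs_mul, Real.abs_exp]
      refine mul_le_mul hω (Real.exp_le_exp.2 ?_) (Real.exp_pos _).le ((abs_nonneg _).trans hω)
      rw [div_le_iff₀ (by positivity)]
      exact mul_le_mul_of_nonneg_left ((hψ ω).2.trans (by linarith)) hc
    have hYm := henv.measurable_excessLoss ht hf' hs'
    rw [hsucc]
    refine ⟨(hUm.mono (𝓗.mono (Nat.le_succ n)) le_rfl).mul (hYm.neg.div_const _).exp,
      ⟨C * Real.exp c * Real.exp 1, ?_⟩, ?_⟩
    · filter_upwards [hUC, ae_round henv halg h𝓕 hγ hl h1 h2 hn] with ω h3 h4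
      rw [abs_mul, Real.abs_exp]
      refine mul_le_mul h3 (Real.exp_le_exp.2 ?_) (Real.exp_pos _).le ((abs_nonneg _).trans h3)
      rw [div_le_one (by positivity)]
      have := abs_sum_excess_le h4.1 (fun a => (hf' a).2 (I.context (n + 1) ω))
        (fun a => (hs' a).2 (I.context (n + 1) ω)) h4.2
      have := (abs_le.1 this).1
      simp only [Interaction.excessLoss]
      linarith
    · refine (integral_mul_exp_excessLoss_le henv halg h𝓕 hγ hl h1 h2 hn hc hf hstar hreal hUm
        (fun ω => by simp only [M, errorExp]; positivity) hUC).trans (le_of_eq_of_le ?_ hint)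
      refine integral_congr_ae (Filter.Eventually.of_forall fun ω => ?_)
      simp only
      rw [mul_assoc, ← Real.exp_add, neg_div, add_neg_cancel, Real.exp_zero, mul_one]

/-- With high probability, the errors of all functions of the class under the past policies are
bounded by their excess losses. -/
lemma measureReal_errorExp_ge_le (henv : IsEnvironment P 𝓗 I D c T)
    (halg : IsAlgorithmRun P 𝓗 I 𝓕 rank k hk hkA γ T) (h𝓕 : ∀ f ∈ 𝓕, IsUnitValued f)
    (hγ : ∀ l, 0 ≤ γ l) (hc : 0 ≤ c) {fstar : X → Fin A → ℝ}
    (hstar : fstar ∈ 𝓕) (hreal : IsRegressionFunction D fstar) (L : ℝ) :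
    P.real (⋃ n ∈ Finset.Icc 1 T, ⋃ f ∈ 𝓕,
      {ω | Real.exp L ≤ errorExp (D.map Prod.fst) I rank k hk hkA γ c f fstar n ω}) ≤
        T * (𝓕.card * Real.exp (-L)) := by
  have h1 : ∀ n ∈ Finset.Icc 1 T, ∀ f ∈ 𝓕, P.real
      {ω | Real.exp L ≤ errorExp (D.map Prod.fst) I rank k hk hkA γ c f fstar n ω} ≤
        Real.exp (-L) := by
    intro n hn f hf
    obtain ⟨hm, ⟨C, hC⟩, hint⟩ := integral_errorExp_le henv halg h𝓕 hγ hc hf hstar hreal n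
      (Finset.mem_Icc.1 hn).2
    have h2 := mul_meas_ge_le_integral_of_nonneg (μ := P)
      (Filter.Eventually.of_forall fun ω => (Real.exp_pos _).le)
      (Integrable.of_bound (hm.mono (𝓗.le n) le_rfl).aestronglyMeasurable C hC) (Real.exp L)
    rw [Real.exp_neg, ← one_div, le_div_iff₀' (Real.exp_pos L)]
    exact h2.trans hint
  refine (measureReal_biUnion_finset_le _ _).trans ?_
  refine (Finset.sum_le_card_nsmul _ _ (𝓕.card * Real.exp (-L)) fun n hn => ?_).trans ?_
  · refine (measureReal_biUnion_finset_le _ _).trans ?_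
    refine (Finset.sum_le_card_nsmul _ _ _ fun f hf => h1 n hn f hf).trans ?_
    rw [nsmul_eq_mul]
  · rw [nsmul_eq_mul, Nat.card_Icc, Nat.add_sub_cancel]

end Concentration

/-! ### Conditional regret of a round -/

section Regret

variable {X Ω : Type*} {A : ℕ} [MeasurableSpace X] [mΩ : MeasurableSpace Ω] {P : Measure Ω}
  [IsProbabilityMeasure P] {𝓗 : Filtration ℕ mΩ} {I : Interaction X Ω A}
  {D : Measure (X × (Fin A → ℝ))} {c : ℝ} {T : ℕ} {𝓕 : Finset (X → Fin A → ℝ)}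
  {rank : (X → Fin A → ℝ) → X → Equiv.Perm (Fin A)} {k : ℕ} {hk : 1 ≤ k} {hkA : k ≤ A}
  {γ : ℕ → ℝ}

/-- The conditional regret of a round is the regret of the policy of its epoch. -/
lemma integrable_gap_and_condExp_gap (henv : IsEnvironment P 𝓗 I D c T)
    (halg : IsAlgorithmRun P 𝓗 I 𝓕 rank k hk hkA γ T) (h𝓕 : ∀ f ∈ 𝓕, IsUnitValued f)
    (hγ : ∀ l, 0 ≤ γ l) {l t : ℕ} (hl : 1 ≤ l) (h1 : epochEnd (l - 1) < t) (h2 : t ≤ epochEnd l)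
    (htT : t ≤ T) {fstar : X → Fin A → ℝ} (hs : IsUnitValued fstar) :
    Integrable (fun ω => policyRegret (D.map Prod.fst) k fstar
        (epochPolicy I rank k hk hkA γ l ω)) P ∧
      P[fun ω => gap k (fstar (I.context t ω)) (I.chosen t ω) | 𝓗 (t - 1)] =ᵐ[P]
        fun ω => policyRegret (D.map Prod.fst) k fstar (epochPolicy I rank k hk hkA γ l ω) := by
  have ht : t ∈ Finset.Icc 1 T := Finset.mem_Icc.2 ⟨by omega, htT⟩
  have := henv.isProbabilityMeasure_map_fst ht
  have hpol := isPolicy_epochPolicy halg h𝓕 hγ hl (h1.trans_le htT)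
  have hρm : Measurable[𝓗 (t - 1)] fun ω => policyRegret (D.map Prod.fst) k fstar
      (epochPolicy I rank k hk hkA γ l ω) :=
    measurable_comp_epochPolicy halg hl h1 htT fun q => policyRegret (D.map Prod.fst) k fstar q
  have hρi : Integrable (fun ω => policyRegret (D.map Prod.fst) k fstar
      (epochPolicy I rank k hk hkA γ l ω)) P := by
    refine Integrable.of_bound (hρm.mono (𝓗.le _) le_rfl).aestronglyMeasurable k
      (Filter.Eventually.of_forall fun ω => ?_)
    rw [Real.norm_of_nonneg (policyRegret_nonneg _ hk hkA hs (hpol ω))]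
    exact policyRegret_le _ hk hkA hs (hpol ω)
  have hh : ∀ S, Measurable fun x => gap k (fstar x) S := fun S =>
    (measurable_topValue hs).sub (Finset.measurable_sum _ fun a _ => (hs a).1)
  have hB : ∀ x S, |gap k (fstar x) S| ≤ k + A := by
    intro x S
    have h3 := topValue_nonneg hk hkA fun a => ((hs a).2 x).1
    have h4 := topValue_le hk hkA fun a => ((hs a).2 x).2
    have h5 : 0 ≤ ∑ a ∈ S, fstar x a := Finset.sum_nonneg fun a _ => ((hs a).2 x).1
    have h6 : ∑ a ∈ S, fstar x a ≤ A := by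
      refine (Finset.sum_le_card_nsmul _ _ 1 fun a _ => ((hs a).2 x).2).trans ?_
      have := Finset.card_le_univ S
      rw [Fintype.card_fin] at this
      rw [nsmul_eq_mul, mul_one]
      exact_mod_cast this
    rw [gap, abs_le]
    constructor <;> linarith
  have hgi : Integrable (fun ω => gap k (fstar (I.context t ω)) (I.chosen t ω)) P :=
    Integrable.of_bound ((henv.measurable_comp_chosen ht hh).mono (𝓗.le t)
      le_rfl).aestronglyMeasurable (k + A) (Filter.Eventually.of_forall fun ω => hB _ _)
  have hexp : ∀ ω, ∫ x, ∑ S, selectionProb k hk hkA (γ l) (I.estimate l ω x)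
      (rank (I.estimate l ω) x) S * gap k (fstar x) S ∂(D.map Prod.fst) =
      policyRegret (D.map Prod.fst) k fstar (epochPolicy I rank k hk hkA γ l ω) := by
    intro ω
    unfold policyRegret
    congr 1
    funext x
    simp only [gap, mul_sub, Finset.sum_sub_distrib, ← Finset.sum_mul, sum_selectionProb,
      sum_selectionProb_mul_sum, one_mul, explorePolicy]
  refine ⟨hρi, (ae_eq_condExp_of_forall_setIntegral_eq (𝓗.le _) hgi
    (fun s _ _ => hρi.integrableOn) (fun s hs' _ => ?_)
    hρm.aestronglyMeasurable).symm⟩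
  -- Indicators of past events as weights test the defining property of the conditional expectation.
  have h3 := integral_mul_chosen henv halg h𝓕 hγ hl h1 h2 htT
    (U := s.indicator fun _ => (1 : ℝ)) (measurable_const.indicator hs') (C := 1)
    (Filter.Eventually.of_forall fun ω => by by_cases hω : ω ∈ s <;> simp [hω]) hh hB
  simp only [hexp] at h3
  have h4 : ∀ (φ : Ω → ℝ) ω, s.indicator (fun _ => (1 : ℝ)) ω * φ ω = s.indicator φ ω :=
    fun φ ω => by by_cases hω : ω ∈ s <;> simp [hω]
  rw [← integral_indicator (𝓗.le _ s hs'), ← integral_indicator (𝓗.le _ s hs')]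
  have h5 : ∀ φ : Ω → ℝ, ∫ ω, s.indicator φ ω ∂P =
      ∫ ω, s.indicator (fun _ => (1 : ℝ)) ω * φ ω ∂P := fun φ =>
    integral_congr_ae (Filter.Eventually.of_forall fun ω => (h4 φ ω).symm)
  rw [h5, h5]
  exact h3.symm

end Regret

/-! ### Scaling factors -/

section Scaling

variable {c δ : ℝ} {A k n T : ℕ}

lemma scaling_nonneg (l : ℕ) : 0 ≤ scaling c A k n T δ l :=
  mul_nonneg (by norm_num) (Real.sqrt_nonneg _)

lemma scaling_one : scaling c A k n T δ 1 = 0 := by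
  simp [scaling, epochEnd]

lemma scaling_mono (hc : 0 < c) (hkA : k ≤ A) (hL : 0 < Real.log ((n : ℝ) * (T : ℝ) ^ 3 / δ)) :
    Monotone (scaling c A k n T δ) := by
  intro i j hij
  have hm : (k : ℝ) ≤ A := by exact_mod_cast hkA
  have h : (epochEnd (i - 1) : ℝ) ≤ epochEnd (j - 1) := by
    exact_mod_cast epochEnd_mono (Nat.sub_le_sub_right hij 1)
  refine mul_le_mul_of_nonneg_left (Real.sqrt_le_sqrt ?_) (by norm_num)
  refine div_le_div_of_nonneg_right (mul_le_mul_of_nonneg_left h ?_) (by positivity)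
  exact mul_nonneg hc.le (by linarith)

/-- `165888 = 32 ^ 2 * 162`. -/
lemma scaling_sq (hc : 0 < c) (hkA : k ≤ A) (hL : 0 < Real.log ((n : ℝ) * (T : ℝ) ^ 3 / δ))
    (l : ℕ) : scaling c A k n T δ l ^ 2 = c * ((A : ℝ) - k + 1) * (epochEnd (l - 1) : ℝ) /
      (165888 * Real.log ((n : ℝ) * (T : ℝ) ^ 3 / δ)) := by
  have hm : (k : ℝ) ≤ A := by exact_mod_cast hkA
  have hm' : 0 ≤ (A : ℝ) - k + 1 := by linarith
  rw [scaling, mul_pow, Real.sq_sqrt (by positivity)]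
  field_simp
  ring

lemma epochEnd_pos {l : ℕ} (hl : 2 ≤ l) : 0 < epochEnd (l - 1) := by
  rw [epochEnd, if_neg (by omega)]
  exact Nat.two_pow_pos _

lemma epochEnd_eq_two_mul {l : ℕ} (hl : 2 ≤ l) : epochEnd l = 2 * epochEnd (l - 1) := by
  rw [epochEnd, epochEnd, if_neg (by omega), if_neg (by omega), ← pow_succ']
  congr 1
  omega

lemma scaling_pos (hc : 0 < c) (hkA : k ≤ A) (hL : 0 < Real.log ((n : ℝ) * (T : ℝ) ^ 3 / δ))
    {l : ℕ} (hl : 2 ≤ l) : 0 < scaling c A k n T δ l := by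
  have hm : (k : ℝ) ≤ A := by exact_mod_cast hkA
  have hm' : 0 < (A : ℝ) - k + 1 := by linarith
  have hN : (0 : ℝ) < epochEnd (l - 1) := by exact_mod_cast epochEnd_pos hl
  exact mul_pos (by norm_num) (Real.sqrt_pos.2 (by positivity))

end Scaling

/-! ### Regret of a round outside the exceptional event -/

section RoundBound

variable {X Ω : Type*} {A : ℕ} [MeasurableSpace X] [mΩ : MeasurableSpace Ω] {P : Measure Ω}
  {𝓗 : Filtration ℕ mΩ} {I : Interaction X Ω A}
  {c δ : ℝ} {T : ℕ} {𝓕 : Finset (X → Fin A → ℝ)}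
  {rank : (X → Fin A → ℝ) → X → Equiv.Perm (Fin A)} {k : ℕ} {hk : 1 ≤ k} {hkA : k ≤ A}

/-- The regret of the policy in round `t` on the event that all errors are controlled. -/
lemma policyRegret_epochPolicy_le (μ : Measure X) [IsProbabilityMeasure μ]
    (hc : 0 < c) (hc1 : c ≤ 1)
    (hL : 1 ≤ Real.log ((𝓕.card : ℝ) * (T : ℝ) ^ 3 / δ))
    (halg : IsAlgorithmRun P 𝓗 I 𝓕 rank k hk hkA (scaling c A k 𝓕.card T δ) T)
    (h𝓕 : ∀ f ∈ 𝓕, IsUnitValued f) {fstar : X → Fin A → ℝ} (hstar : fstar ∈ 𝓕) {ω : Ω}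
    (hω : ∀ n ∈ Finset.Icc 1 T, ∀ f ∈ 𝓕,
      errorExp μ I rank k hk hkA (scaling c A k 𝓕.card T δ) c f fstar n ω <
        Real.exp (Real.log ((𝓕.card : ℝ) * (T : ℝ) ^ 3 / δ))) {t : ℕ} (ht : t ∈ Finset.Icc 1 T) :
    policyRegret μ k fstar
        (epochPolicy I rank k hk hkA (scaling c A k 𝓕.card T δ) (epochIndex t) ω) ≤
      6336 * (k * √(c⁻¹ * ((A : ℝ) - k + 1) *
        Real.log ((𝓕.card : ℝ) * (T : ℝ) ^ 3 / δ))) * (1 / √t) := by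
  obtain ⟨ht1, htT⟩ := Finset.mem_Icc.1 ht
  have hl := one_le_epochIndex t
  have h1 := epochEnd_epochIndex_sub_one_lt ht1
  have h2 := le_epochEnd_epochIndex t
  set γ := scaling c A k 𝓕.card T δ
  set l := epochIndex t
  set L := Real.log ((𝓕.card : ℝ) * (T : ℝ) ^ 3 / δ) with hLdef
  set m : ℝ := (A : ℝ) - k + 1 with hmdef
  have hm : 1 ≤ m := by
    have : (k : ℝ) ≤ A := by exact_mod_cast hkA
    rw [hmdef]; linarith
  have hL0 : 0 < L := by linarith
  have hk' : (1 : ℝ) ≤ k := by exact_mod_cast hk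
  have ht' : (1 : ℝ) ≤ t := by exact_mod_cast ht1
  have hpol := isPolicy_epochPolicy halg h𝓕 scaling_nonneg hl (h1.trans_le htT) ω
  have hrhs : 6336 * (k * √(c⁻¹ * m * L)) * (1 / √t) =
      √(6336 ^ 2 * (k ^ 2 * (c⁻¹ * m * L) / t)) := by
    rw [← Real.sqrt_sq (show 0 ≤ 6336 * (k * √(c⁻¹ * m * L)) * (1 / √t) by positivity)]
    congr 1
    rw [mul_pow, mul_pow, mul_pow, div_pow, Real.sq_sqrt (by positivity),
      Real.sq_sqrt (by positivity)]
    ring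
  rw [hrhs]
  -- In the first epoch the trivial bound `k` suffices, since `t ≤ 2`.
  rcases hl.eq_or_lt with hl1 | hl2
  · have hT2 : (t : ℝ) ≤ 2 := by
      rw [← hl1] at h2
      exact_mod_cast h2
    refine (policyRegret_le μ hk hkA (h𝓕 _ hstar) hpol).trans (Real.le_sqrt_of_sq_le ?_)
    rw [← mul_div_assoc, le_div_iff₀ (by positivity)]
    have h3 : 1 ≤ c⁻¹ * m * L :=
      one_le_mul_of_one_le_of_one_le (one_le_mul_of_one_le_of_one_le
        ((one_le_inv₀ hc).2 hc1) hm) hL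
    nlinarith [sq_nonneg (k : ℝ), mul_le_mul_of_nonneg_left h3 (sq_nonneg (k : ℝ)),
      mul_le_mul_of_nonneg_left hT2 (sq_nonneg (k : ℝ))]
  · have hlT : ∀ i, i ≤ l → epochEnd (i - 1) < T := fun i hi =>
      (epochEnd_mono (Nat.sub_le_sub_right hi 1)).trans_lt (h1.trans_le htT)
    have key := mul_policyRegret_le_of_policyError_le μ hk hkA h𝓕 halg.isRanking
      halg.measurable_rank hstar (scaling_mono hc hkA hL0) scaling_one hl
      (fun j => I.estimate j ω) (fun j hj hjl => halg.estimate_mem j hj (hlT j hjl) ω) ?_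
    · have hγ := scaling_pos hc hkA hL0 hl2
      have hγ2 := scaling_sq hc hkA hL0 l
      have hN : (0 : ℝ) < epochEnd (l - 1) := by exact_mod_cast epochEnd_pos hl2
      have hN2 : (t : ℝ) ≤ 2 * epochEnd (l - 1) := by
        rw [epochEnd_eq_two_mul hl2] at h2
        exact_mod_cast h2
      rw [← le_div_iff₀' hγ] at key
      refine key.trans (Real.le_sqrt_of_sq_le ?_)
      rw [div_pow, hγ2]
      rw [div_div_eq_mul_div, ← mul_div_assoc, div_le_div_iff₀ (by positivity) (by positivity)]
      -- `6336 ^ 2 = 2 * 11 ^ 2 * 165888`, where the factor 2 comes from `t ≤ 2 * epochEnd (l - 1)`.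
      have h3 : (11 * (k * m)) ^ 2 * (165888 * L) * t =
          20072448 * (k ^ 2 * m ^ 2 * L) * t := by ring
      have h4 : 6336 ^ 2 * (k ^ 2 * (c⁻¹ * m * L)) * (c * m * (epochEnd (l - 1) : ℝ)) =
          20072448 * (k ^ 2 * m ^ 2 * L) * (2 * epochEnd (l - 1)) := by
        field_simp
        norm_num
      exact le_of_eq_of_le h3 ((mul_le_mul_of_nonneg_left hN2 (by positivity)).trans_eq h4.symm)
    · intro i hi hil
      refine ⟨scaling_pos hc hkA hL0 hi, ?_⟩
      have hγ2 := scaling_sq hc hkA hL0 i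
      have hN := epochEnd_pos hi
      have hNR : (0 : ℝ) < epochEnd (i - 1) := by exact_mod_cast hN
      have hest := halg.estimate_mem i (by omega) (hlT i hil) ω
      have h3 := hω (epochEnd (i - 1)) (Finset.mem_Icc.2 ⟨hN, (hlT i hil).le⟩) _ hest
      rw [errorExp, Real.exp_lt_exp, Finset.sum_sub_distrib, ← Finset.sum_div,
        ← Finset.sum_div, ← Finset.mul_sum, I.sum_excessLoss] at h3
      have h4 := halg.estimate_le i (by omega) (hlT i hil) ω fstar hstar
      have h5 : (I.squaredLoss (epochEnd (i - 1)) (I.estimate i ω) ω -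
          I.squaredLoss (epochEnd (i - 1)) fstar ω) / (8 * k) ≤ 0 :=
        div_nonpos_of_nonpos_of_nonneg (by linarith) (by positivity)
      have h6 : c * ∑ s ∈ Finset.Icc 1 (epochEnd (i - 1)), policyError μ
          (epochPolicy I rank k hk hkA γ (epochIndex s) ω) (I.estimate i ω) fstar / (16 * k) ≤
          L := by
        rw [← Finset.sum_div, ← mul_div_assoc]
        linarith
      rw [← Finset.sum_div, ← mul_div_assoc, div_le_iff₀ (by positivity)] at h6
      -- Pigeonhole: the average error is at most `16 * k * L / (c * N)` with `N = epochEnd (i -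
      -- 1)`, far below the threshold, which equals `165888 * k * L / (c * N)`.
      obtain ⟨s, hs, hle⟩ := Finset.exists_le_of_sum_le (s := Finset.Icc 1 (epochEnd (i - 1)))
        (f := fun s => policyError μ
          (epochPolicy I rank k hk hkA γ (epochIndex s) ω) (I.estimate i ω) fstar)
        (g := fun _ => k * m / γ i ^ 2) ⟨1, Finset.mem_Icc.2 ⟨le_rfl, hN⟩⟩ (by
          rw [Finset.sum_const, Nat.card_Icc, Nat.add_sub_cancel, nsmul_eq_mul, hγ2,
            div_div_eq_mul_div, ← mul_div_assoc, le_div_iff₀ (by positivity)]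
          have h7 := mul_le_mul_of_nonneg_right h6
            (show 0 ≤ m * (epochEnd (i - 1) : ℝ) by positivity)
          have h8 : 0 ≤ (epochEnd (i - 1) : ℝ) * (k * m * L) := by positivity
          nlinarith)
      have hs' := Finset.mem_Icc.1 hs
      exact ⟨epochIndex s, one_le_epochIndex s, epochIndex_lt hs'.1 hs'.2, hle⟩

lemma sum_one_div_sqrt_le (n : ℕ) : ∑ t ∈ Finset.Icc 1 n, 1 / √(t : ℝ) ≤ 2 * √n := by
  induction n with
  | zero => simp
  | succ n ih =>
    rw [Finset.sum_Icc_succ_top (by omega)]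
    have h0 : (0 : ℝ) ≤ n := Nat.cast_nonneg n
    have h1 : 0 < √((n + 1 : ℕ) : ℝ) := Real.sqrt_pos.2 (by positivity)
    have h2 := Real.sq_sqrt (show (0 : ℝ) ≤ ((n + 1 : ℕ) : ℝ) by positivity)
    have h3 := Real.sq_sqrt h0
    -- The telescoping step; cleared of denominators it says that `(√(n + 1) - √n) ^ 2` is
    -- nonnegative.
    have h4 : 1 / √((n + 1 : ℕ) : ℝ) ≤ 2 * √((n + 1 : ℕ) : ℝ) - 2 * √n := by
      rw [div_le_iff₀ h1]
      push_cast at h2 ⊢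
      nlinarith [sq_nonneg (√((n : ℝ) + 1) - √n)]
    linarith

end RoundBound

/-! ### Logarithms and the final assembly -/

section Bounds

variable {n T : ℕ} {δ : ℝ}

lemma one_le_log_mul_cube_div (hn : 1 ≤ n) (hT : 2 ≤ T) (hδ : 0 < δ) (hδ1 : δ < 1) :
    1 ≤ Real.log ((n : ℝ) * (T : ℝ) ^ 3 / δ) := by
  have hn' : (1 : ℝ) ≤ n := by exact_mod_cast hn
  have hT' : (2 : ℝ) ≤ T := by exact_mod_cast hT
  rw [Real.le_log_iff_exp_le (by positivity), le_div_iff₀ hδ]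
  have h1 := Real.exp_one_lt_d9
  have h2 : (2 : ℝ) ^ 3 ≤ (T : ℝ) ^ 3 := pow_le_pow_left₀ (by norm_num) hT' 3
  nlinarith [Real.exp_pos 1]

lemma log_mul_cube_div_le (hn : 1 ≤ n) (hT : 2 ≤ T) (hδ : 0 < δ) (hδ1 : δ < 1) :
    Real.log ((n : ℝ) * (T : ℝ) ^ 3 / δ) ≤ 3 * Real.log ((n : ℝ) * T / δ) := by
  have hn' : (1 : ℝ) ≤ n := by exact_mod_cast hn
  have hT' : (2 : ℝ) ≤ T := by exact_mod_cast hT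
  have h3 : (3 : ℝ) * Real.log ((n : ℝ) * T / δ) = Real.log (((n : ℝ) * T / δ) ^ 3) := by
    rw [Real.log_pow]
    norm_num
  rw [h3]
  refine Real.log_le_log (by positivity) ?_
  rw [div_pow, mul_pow]
  refine div_le_div₀ (by positivity) (mul_le_mul_of_nonneg_right ?_ (by positivity))
    (by positivity) ?_
  · exact le_self_pow₀ hn' (by norm_num)
  · exact pow_le_of_le_one hδ.le hδ1.le (by norm_num)

lemma one_half_le_log_mul_div (hn : 1 ≤ n) (hT : 2 ≤ T) (hδ : 0 < δ) (hδ1 : δ < 1) :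
    1 / 2 ≤ Real.log ((n : ℝ) * T / δ) := by
  have hn' : (1 : ℝ) ≤ n := by exact_mod_cast hn
  have hT' : (2 : ℝ) ≤ T := by exact_mod_cast hT
  have h1 : Real.log 2 ≤ Real.log ((n : ℝ) * T / δ) := by
    refine Real.log_le_log (by norm_num) ?_
    rw [le_div_iff₀ hδ]
    nlinarith
  linarith [Real.log_two_gt_d9]

end Bounds

/-- The regret bound on the event that all errors are controlled, the probability of the
complement of this event, and the form of the conditional regret. -/
theorem exists_event_condRegret {X Ω : Type*} [MeasurableSpace X] [mΩ : MeasurableSpace Ω]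
    {P : Measure Ω} [IsProbabilityMeasure P] {𝓗 : Filtration ℕ mΩ} {A k T : ℕ} {hk : 1 ≤ k}
    {hkA : k ≤ A} (hT : 2 ≤ T) {c δ : ℝ} (hc : 0 < c) (hc1 : c ≤ 1) (hδ : 0 < δ) (hδ1 : δ < 1)
    {D : Measure (X × (Fin A → ℝ))} {𝓕 : Finset (X → Fin A → ℝ)} (h𝓕 : IsRegressionClass 𝓕)
    {fstar : X → Fin A → ℝ} (hstar : fstar ∈ 𝓕) (hreal : IsRegressionFunction D fstar)
    {I : Interaction X Ω A} {rank : (X → Fin A → ℝ) → X → Equiv.Perm (Fin A)}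
    (henv : IsEnvironment P 𝓗 I D c T)
    (halg : IsAlgorithmRun P 𝓗 I 𝓕 rank k hk hkA (scaling c A k 𝓕.card T δ) T) :
    ∃ (R : Ω → ℝ) (E : Set Ω), condRegret P 𝓗 I k fstar T =ᵐ[P] R ∧
      regret P I k fstar T = ∫ ω, R ω ∂P ∧ Integrable R P ∧ MeasurableSet E ∧
      P.real E ≤ δ / T ^ 2 ∧ (∀ ω, R ω ≤ T * k) ∧
      ∀ ω, ω ∉ E → R ω ≤ 25344 * (k * √(c⁻¹ * ((A : ℝ) - k + 1) * T *
        Real.log ((𝓕.card : ℝ) * T / δ))) := by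
  have hU : ∀ f ∈ 𝓕, IsUnitValued f := h𝓕
  have hn : 1 ≤ 𝓕.card := Finset.card_pos.2 ⟨fstar, hstar⟩
  have hn' : (1 : ℝ) ≤ 𝓕.card := by exact_mod_cast hn
  have hT' : (2 : ℝ) ≤ T := by exact_mod_cast hT
  have hk' : (1 : ℝ) ≤ k := by exact_mod_cast hk
  have hL := one_le_log_mul_cube_div hn hT hδ hδ1
  have hL3 := log_mul_cube_div_le hn hT hδ hδ1
  have hexpL : Real.exp (-Real.log ((𝓕.card : ℝ) * (T : ℝ) ^ 3 / δ)) =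
      δ / (𝓕.card * T ^ 3) := by
    rw [Real.exp_neg, Real.exp_log (by positivity), inv_div]
  have hround := fun t (ht : t ∈ Finset.Icc 1 T) => integrable_gap_and_condExp_gap henv halg hU
    scaling_nonneg (one_le_epochIndex t)
    (epochEnd_epochIndex_sub_one_lt (Finset.mem_Icc.1 ht).1) (le_epochEnd_epochIndex t)
    (Finset.mem_Icc.1 ht).2 (hU _ hstar)
  have := henv.isProbabilityMeasure_map_fst (Finset.mem_Icc.2 ⟨le_rfl, by omega⟩ :
    1 ∈ Finset.Icc 1 T)
  have hproc := fun n (hnT : n ∈ Finset.Icc 1 T) f (hf : f ∈ 𝓕) => (integral_errorExp_le henv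
    halg hU scaling_nonneg hc.le hf hstar hreal n (Finset.mem_Icc.1 hnT).2).1
  have hbad := measureReal_errorExp_ge_le henv halg hU scaling_nonneg hc.le hstar hreal
    (Real.log ((𝓕.card : ℝ) * (T : ℝ) ^ 3 / δ))
  have hbound := fun ω hω t (ht : t ∈ Finset.Icc 1 T) => policyRegret_epochPolicy_le (ω := ω)
    (D.map Prod.fst) hc hc1 hL halg hU hstar hω ht
  set γ := scaling c A k 𝓕.card T δ
  set L := Real.log ((𝓕.card : ℝ) * (T : ℝ) ^ 3 / δ)
  set L' := Real.log ((𝓕.card : ℝ) * T / δ)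
  set m : ℝ := (A : ℝ) - k + 1 with hmdef
  have hm : 1 ≤ m := by
    have : (k : ℝ) ≤ A := by exact_mod_cast hkA
    rw [hmdef]; linarith
  set ρ : ℕ → Ω → ℝ := fun t ω => policyRegret (D.map Prod.fst) k fstar
    (epochPolicy I rank k hk hkA γ (epochIndex t) ω)
  have hsum_int : Integrable (fun ω => ∑ t ∈ Finset.Icc 1 T, ρ t ω) P :=
    integrable_finsetSum _ fun t ht => (hround t ht).1
  -- The sum of policy regrets is a version of the conditional regret that is bounded everywhere;
  -- the exceptional event is the union in `hbad`.
  refine ⟨fun ω => ∑ t ∈ Finset.Icc 1 T, ρ t ω, _, ?_, ?_, hsum_int, ?_, hbad.trans_eq ?_, ?_, ?_⟩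
  · have h1 : ∀ᵐ ω ∂P, ∀ t ∈ Finset.Icc 1 T,
        (P[fun ω' => gap k (fstar (I.context t ω')) (I.chosen t ω') | 𝓗 (t - 1)]) ω = ρ t ω :=
      (Finset.eventually_all _).2 fun t ht => (hround t ht).2
    filter_upwards [h1] with ω hω
    exact Finset.sum_congr rfl hω
  · rw [integral_finsetSum _ fun t ht => (hround t ht).1]
    refine Finset.sum_congr rfl fun t ht => ?_
    rw [← integral_condExp (𝓗.le (t - 1))]
    exact integral_congr_ae (hround t ht).2
  · exact Finset.measurableSet_biUnion _ fun n hnT => Finset.measurableSet_biUnion _ fun f hf =>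
      measurableSet_le measurable_const ((hproc n hnT f hf).mono (𝓗.le n) le_rfl)
  · rw [hexpL]
    field_simp
  · intro ω
    refine (Finset.sum_le_card_nsmul _ _ (k : ℝ) fun t ht => ?_).trans_eq (by simp)
    exact policyRegret_le _ hk hkA (hU _ hstar) (isPolicy_epochPolicy halg hU scaling_nonneg
      (one_le_epochIndex t) ((epochEnd_epochIndex_sub_one_lt (Finset.mem_Icc.1 ht).1).trans_le
        (Finset.mem_Icc.1 ht).2) ω)
  · intro ω hω
    simp only [Set.mem_iUnion, Set.mem_ofPred_eq, not_exists, not_le] at hω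
    have h1 := Finset.sum_le_sum (hbound ω hω)
    rw [← Finset.mul_sum] at h1
    have h2 := mul_le_mul_of_nonneg_left (sum_one_div_sqrt_le T)
      (show 0 ≤ 6336 * (k * √(c⁻¹ * m * L)) by positivity)
    refine h1.trans (h2.trans ?_)
    -- `L ≤ 3 * L' ≤ 4 * L'`; together with `2 * 6336` from the sum over rounds this makes 25344.
    have h3 : √(c⁻¹ * m * L) * √T ≤ 2 * √(c⁻¹ * m * T * L') := by
      rw [← Real.sqrt_mul (by positivity), show (2 : ℝ) = √(2 ^ 2) by
        rw [Real.sqrt_sq (by norm_num)], ← Real.sqrt_mul (by norm_num)]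
      refine Real.sqrt_le_sqrt ?_
      have h4 := mul_le_mul_of_nonneg_left hL3 (show 0 ≤ c⁻¹ * m * T by positivity)
      have h5 : 0 ≤ c⁻¹ * m * T * L' := mul_nonneg (by positivity) (by linarith)
      nlinarith
    have h6 := mul_le_mul_of_nonneg_left h3 (show 0 ≤ 12672 * (k : ℝ) by positivity)
    nlinarith

end TopKBandit

theorem theorem1 :
    ∃ C : ℝ, 0 < C ∧
      ∀ (X Ω : Type*) [MeasurableSpace X] [mΩ : MeasurableSpace Ω]
        (P : Measure Ω) [IsProbabilityMeasure P] (𝓗 : Filtration ℕ mΩ)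
        (A k T : ℕ) (hk : 1 ≤ k) (hkA : k ≤ A) (_hT : 2 ≤ T)
        (c δ : ℝ) (_hc : 0 < c) (_hc1 : c ≤ 1) (_hδ : 0 < δ) (_hδ1 : δ < 1)
        (D : Measure (X × (Fin A → ℝ)))
        (𝓕 : Finset (X → Fin A → ℝ)) (_hF : TopKBandit.IsRegressionClass 𝓕)
        (fstar : X → Fin A → ℝ) (_hmem : fstar ∈ 𝓕)
        (_hreal : TopKBandit.IsRegressionFunction D fstar)
        (I : TopKBandit.Interaction X Ω A)
        (rank : (X → Fin A → ℝ) → X → Equiv.Perm (Fin A))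
        (_henv : TopKBandit.IsEnvironment P 𝓗 I D c T)
        (_halg : TopKBandit.IsAlgorithmRun P 𝓗 I 𝓕 rank k hk hkA
          (TopKBandit.scaling c A k 𝓕.card T δ) T),
        1 - δ ≤ P.real {ω | TopKBandit.condRegret P 𝓗 I k fstar T ω ≤
            C * (k * √(c⁻¹ * ((A : ℝ) - k + 1) * T * Real.log ((𝓕.card : ℝ) * T / δ)))} ∧
          TopKBandit.regret P I k fstar T ≤
            C * (k * √(c⁻¹ * ((A : ℝ) - k + 1) * T * Real.log ((𝓕.card : ℝ) * T / δ))) := by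
  -- 25344 from the controlled event, plus room for the term `k ≤ B` of the exceptional event in the
  -- expected regret.
  refine ⟨25346, by norm_num, ?_⟩
  intro X Ω _ mΩ P _ 𝓗 A k T hk hkA hT c δ hc hc1 hδ hδ1 D 𝓕 hF fstar hmem hreal I rank henv halg
  obtain ⟨R, E, hR, hreg, hRi, hE, hPE, hRle, hgood⟩ :=
    TopKBandit.exists_event_condRegret hT hc hc1 hδ hδ1 hF hmem hreal henv halg
  have hn : 1 ≤ 𝓕.card := Finset.card_pos.2 ⟨fstar, hmem⟩
  have hT' : (2 : ℝ) ≤ T := by exact_mod_cast hT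
  have hk' : (1 : ℝ) ≤ k := by exact_mod_cast hk
  have hL := TopKBandit.one_half_le_log_mul_div hn hT hδ hδ1
  set L := Real.log ((𝓕.card : ℝ) * T / δ)
  have hm : 1 ≤ (A : ℝ) - k + 1 := by
    have : (k : ℝ) ≤ A := by exact_mod_cast hkA
    linarith
  set B := (k : ℝ) * √(c⁻¹ * ((A : ℝ) - k + 1) * T * L)
  have hkB : (k : ℝ) ≤ B := by
    refine le_mul_of_one_le_right (by linarith) (Real.one_le_sqrt.2 ?_)
    have h1 : 1 ≤ c⁻¹ * ((A : ℝ) - k + 1) :=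
      one_le_mul_of_one_le_of_one_le ((one_le_inv₀ hc).2 hc1) hm
    have h2 : 1 ≤ (T : ℝ) * L := by nlinarith
    rw [mul_assoc]
    exact one_le_mul_of_one_le_of_one_le h1 h2
  have hT2 : (1 : ℝ) ≤ (T : ℝ) ^ 2 := one_le_pow₀ (by linarith)
  refine ⟨?_, ?_⟩
  -- Covering the space by the two sets and using subadditivity avoids any measurability of the
  -- first one.
  · have h1 : (Set.univ : Set Ω) ≤ᵐ[P] ({ω | TopKBandit.condRegret P 𝓗 I k fstar T ω ≤ 25346 * B} ∪
        E : Set Ω) := by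
      filter_upwards [hR] with ω hω _
      by_cases hωE : ω ∈ E
      · exact Or.inr hωE
      · refine Or.inl ?_
        change TopKBandit.condRegret P 𝓗 I k fstar T ω ≤ 25346 * B
        rw [hω]
        linarith [hgood ω hωE]
    have h2 : 1 ≤ P.real ({ω | TopKBandit.condRegret P 𝓗 I k fstar T ω ≤ 25346 * B} ∪ E) := by
      rw [← probReal_univ (μ := P)]
      exact ENNReal.toReal_mono (measure_ne_top _ _) (measure_mono_ae h1)
    have h3 := measureReal_union_le (μ := P)
      {ω | TopKBandit.condRegret P 𝓗 I k fstar T ω ≤ 25346 * B} E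
    have h4 : δ / (T : ℝ) ^ 2 ≤ δ := div_le_self hδ.le hT2
    linarith
  · have hi : Integrable (E.indicator fun _ => (T : ℝ) * k) P := (integrable_const _).indicator hE
    have h1 : ∀ ω, R ω ≤ 25344 * B + E.indicator (fun _ => (T : ℝ) * k) ω := by
      intro ω
      by_cases hω : ω ∈ E
      · simp only [hω, Set.indicator_of_mem]
        linarith [hRle ω]
      · simp only [hω, not_false_eq_true, Set.indicator_of_notMem]
        linarith [hgood ω hω]
    have h2 := integral_mono hRi ((integrable_const (25344 * B)).add hi) h1
    rw [integral_add' (integrable_const _) hi, integral_indicator_const _ hE] at h2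
    simp only [integral_const, probReal_univ, smul_eq_mul] at h2
    -- The cube of `T` in the logarithm made the exceptional event rare enough to absorb the trivial
    -- regret `T * k`.
    have h3 : P.real E * ((T : ℝ) * k) ≤ k := by
      have h4 : P.real E * T ≤ 1 := by
        have h5 := (le_div_iff₀ (by positivity)).1 hPE
        have h6 : P.real E * T * T ≤ 1 * T := by nlinarith [sq (T : ℝ)]
        exact le_of_mul_le_mul_right h6 (by linarith)
      nlinarith
    rw [hreg]
    linarith
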